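/- Let $q$ be a power of an odd prime $p$, let $F=GF(q)$, let $n\ge 1$, and let $\mathrm{Sp}(2n,q)$ be the group of $2n\times 2n$ matrices over $F$ acting on the right on row vectors $(x,y)\in V=F^n\times F^n$ and preserving $\varphi((x_1,y_1),(x_2,y_2))=x_1y_2^T-y_1x_2^T$. Let $\psi(\alpha)=e^{(2\pi i/p)\,\mathrm{tr}(\alpha)}$, with $\mathrm{tr}:F\to GF(p)$ the trace, let $\chi$ be the quadratic character of $F$, and let $\delta=\chi(-1)$. Let $\omega$ be the Weil character of $\mathrm{Sp}(2n,q)$ attached to $\psi$, that is, the character of the representation $W$ of $\mathrm{Sp}(2n,q)$ on the space of complex functions on $F^n$ with $W(g)^{-1}E_vW(g)=E_{vg}$ for all $v\in V$ and $g\in \mathrm{Sp}(2n,q)$, where $(E_{(x,y)}f)(t)=\psi(2xt^T-xy^T)f(t-y)$, so that $E_uE_v=\psi(\varphi(u,v))E_{u+v}$; $W$ is made unique also for $\mathrm{Sp}(2,3)$ by requiring each $W(g)$ to have the same determinant on the even functions as on the odd functions. For a symmetric $n\times n$ matrix $Q$ over $F$ let $g_Q=\begin{bmatrix} I&0\\ Q&I\end{bmatrix}$,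 and let $\Delta(Q)$ be $\chi$ of the product of the nonzero entries of a diagonal matrix congruent to $Q$. Let $B$ be the group of all $g_Q$ and $G=\langle -I\rangle\times B$. For $S$ symmetric let $\lambda_S^{+}=\lambda_S^{1}$ and $\lambda_S^{-}=\lambda_S^{-1}$ be the linear characters of $G$ given by $\lambda_S^{\pm}(g_Q)=\psi(\mathrm{Tr}(SQ))$ and $\lambda_S^{\pm}(-g_Q)=\pm\psi(\mathrm{Tr}(SQ))$. Then $\omega$ can be written as $\omega=\omega_++\omega_-$ with irreducible characters $\omega_+$ of degree $(q^n+1)/2$ and $\omega_-$ of degree $(q^n-1)/2$ of $\mathrm{Sp}(2n,q)$, and for any such $\omega_+$, $\omega_-$ $$\omega_+|G=\frac{1+\delta^n}{2}\lambda_0^{+}+\frac{1-\delta^n}{2}\lambda_0^{-}+\sum_{\substack{\mathrm{rank}\,S=1\\ \Delta(S)=\delta}}\lambda_S^{\delta^n},\qquad \omega_-|G=\sum_{\substack{\mathrm{rank}\,S=1\\ \Delta(S)=\delta}}\lambda_S^{-\delta^n},$$ where the sums run over symmetric $n\times n$ matrices $S$ over $F$. In particular both $\omega_+|B$ and $\omega_-|B$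 are multiplicity free: every irreducible character of $B$ has multiplicity $0$ or $1$ in each of them. -/

import Mathlib

open scoped Matrix

noncomputable section

namespace Weil

/-! ### Characters of finite groups -/

/-- `χ` is the character of an irreducible complex (finite-dimensional) representation of `H`. -/
def IsIrreducibleCharacter {H : Type*} [Group H] (χ : H → ℂ) : Prop :=
  ∃ (d : ℕ) (ρ : Representation ℂ H (Fin d → ℂ)), ρ.IsIrreducible ∧ χ = ρ.character

/-- The usual inner product `|H|⁻¹ ∑ χ(h) conj(θ(h))` of complex functions on a finite group. -/
def charInner {H : Type*} [Group H] [Finite H] (χ θ : H → ℂ) : ℂ :=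
  letI := Fintype.ofFinite H
  (Nat.card H : ℂ)⁻¹ * ∑ h : H, χ h * starRingEnd ℂ (θ h)

/-- A character is multiplicity free when every irreducible character occurs in it with
multiplicity `0` or `1`. -/
def MultiplicityFree {H : Type*} [Group H] [Finite H] (χ : H → ℂ) : Prop :=
  ∀ θ : H → ℂ, IsIrreducibleCharacter θ → charInner χ θ = 0 ∨ charInner χ θ = 1

/-! ### The canonical additive character -/

section CanonicalChar

variable (F : Type*) [Field F] [Finite F]

lemma neZero_ringChar : NeZero (ringChar F) := by
  have := Fact.mk (CharP.char_is_prime F (ringChar F))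
  exact ⟨this.out.ne_zero⟩

/-- The canonical additive character `α ↦ exp (2πi tr(α) / p)` of a finite field of
characteristic `p`, where `tr` is the trace to the prime field. -/
def canonicalChar : AddChar F ℂ :=
  haveI := neZero_ringChar F
  letI : Algebra (ZMod (ringChar F)) F := ZMod.algebra F (ringChar F)
  ZMod.stdAddChar.compAddMonoidHom (Algebra.trace (ZMod (ringChar F)) F).toAddMonoidHom

lemma exists_canonicalChar_ne_one {a : F} (ha : a ≠ 0) : ∃ b, canonicalChar F (b * a) ≠ 1 := by
  have := neZero_ringChar F
  let _ : Algebra (ZMod (ringChar F)) F := ZMod.algebra F (ringChar F)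
  obtain ⟨b, hb⟩ := FiniteField.trace_to_zmod_nondegenerate F ha
  refine ⟨b, fun h => hb ?_⟩
  have h' : ZMod.stdAddChar (Algebra.trace (ZMod (ringChar F)) F (b * a)) = (1 : ℂ) := h
  rw [← AddChar.map_zero_eq_one (ZMod.stdAddChar (N := ringChar F))] at h'
  rw [mul_comm]
  exact ZMod.injective_stdAddChar h'

end CanonicalChar

/-! ### The Weil representation -/

section WeilRepresentation

set_option linter.unusedSectionVars false

variable {F : Type*} [Field F] [Fintype F] {n : ℕ}

/-- Row vectors `(x, y)` with `x, y ∈ F ^ n`; matrices act on the right. -/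
abbrev Vec (F : Type*) (n : ℕ) := Fin n ⊕ Fin n → F

/-- The symplectic group `Sp(2n, F)` of matrices `g` with `g J gᵀ = J`. -/
abbrev Sp (F : Type*) [Field F] (n : ℕ) := Matrix.symplecticGroup (Fin n) F

/-- The space of complex functions on `F ^ n`, of dimension `q ^ n`. -/
abbrev Schr (F : Type*) (n : ℕ) := (Fin n → F) → ℂ

/-- The symplectic form `φ((x₁, y₁), (x₂, y₂)) = x₁ y₂ᵀ - y₁ x₂ᵀ`. -/
def sform (u v : Vec F n) : F :=
  (u ∘ Sum.inl) ⬝ᵥ (v ∘ Sum.inr) - (u ∘ Sum.inr) ⬝ᵥ (v ∘ Sum.inl)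

/-- The Heisenberg operators `(E (x, y) f) t = ψ(2 x tᵀ - x yᵀ) f (t - y)`, where `ψ` is the
canonical additive character. They satisfy `E u * E v = ψ(φ(u, v)) • E (u + v)`. -/
def E (v : Vec F n) : Module.End ℂ (Schr F n) where
  toFun f t := canonicalChar F
      (2 * ((v ∘ Sum.inl) ⬝ᵥ t) - (v ∘ Sum.inl) ⬝ᵥ (v ∘ Sum.inr)) * f (t - v ∘ Sum.inr)
  map_add' f g := by ext t; simp [mul_add]
  map_smul' c f := by ext t; simp [mul_left_comm]

lemma E_apply (v : Vec F n) (f : Schr F n) (t : Fin n → F) :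
    E v f t = canonicalChar F
      (2 * ((v ∘ Sum.inl) ⬝ᵥ t) - (v ∘ Sum.inl) ⬝ᵥ (v ∘ Sum.inr)) * f (t - v ∘ Sum.inr) := rfl

lemma E_mul (u v : Vec F n) : E u * E v = canonicalChar F (sform u v) • E (u + v) := by
  ext1 f
  funext t
  simp only [Module.End.mul_apply, E_apply, LinearMap.smul_apply, Pi.smul_apply, smul_eq_mul]
  have h1 : (u + v) ∘ Sum.inl = u ∘ Sum.inl + v ∘ Sum.inl := rfl
  have h2 : (u + v) ∘ Sum.inr = u ∘ Sum.inr + v ∘ Sum.inr := rfl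
  rw [h1, h2, sub_sub, ← mul_assoc, ← mul_assoc, ← AddChar.map_add_eq_mul,
    ← AddChar.map_add_eq_mul]
  congr 2
  simp only [sform, add_dotProduct, dotProduct_add, dotProduct_sub]
  rw [dotProduct_comm (u ∘ Sum.inr) (v ∘ Sum.inl)]
  ring

lemma E_zero : E (0 : Vec F n) = 1 := by
  ext1 f
  funext t
  have h1 : (0 : Vec F n) ∘ Sum.inl = 0 := rfl
  have h2 : (0 : Vec F n) ∘ Sum.inr = 0 := rfl
  rw [E_apply, h1, h2]
  simp

lemma sform_self (u : Vec F n) : sform u u = 0 := by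
  rw [sform, dotProduct_comm, sub_self]

lemma sform_neg_left (u v : Vec F n) : sform (-u) v = -sform u v := by
  have h1 : (-u) ∘ Sum.inl = -(u ∘ Sum.inl) := rfl
  have h2 : (-u) ∘ Sum.inr = -(u ∘ Sum.inr) := rfl
  rw [sform, h1, h2, sform]
  simp only [neg_dotProduct]
  ring

lemma sform_add_left (u v w : Vec F n) : sform (u + v) w = sform u w + sform v w := by
  have h1 : (u + v) ∘ Sum.inl = u ∘ Sum.inl + v ∘ Sum.inl := rfl
  have h2 : (u + v) ∘ Sum.inr = u ∘ Sum.inr + v ∘ Sum.inr := rfl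
  rw [sform, h1, h2, sform, sform]
  simp only [add_dotProduct]
  ring

lemma sform_comm (u v : Vec F n) : sform u v = -sform v u := by
  rw [sform, sform, dotProduct_comm (u ∘ Sum.inl), dotProduct_comm (u ∘ Sum.inr)]
  ring

lemma E_mul_neg (u : Vec F n) : E u * E (-u) = 1 := by
  rw [E_mul, sform_comm, sform_neg_left, sform_self]
  simp [E_zero]

lemma E_neg_mul (u : Vec F n) : E (-u) * E u = 1 := by
  rw [E_mul, sform_neg_left, sform_self]
  simp [E_zero]

lemma sform_eq (u v : Vec F n) : sform u v = -(u ⬝ᵥ (Matrix.J (Fin n) F *ᵥ v)) := by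
  simp only [sform, Matrix.J, dotProduct, Matrix.mulVec, Fintype.sum_sum_type,
    Matrix.fromBlocks_apply₁₁, Matrix.fromBlocks_apply₁₂, Matrix.fromBlocks_apply₂₁,
    Matrix.fromBlocks_apply₂₂, Function.comp]
  simp [Matrix.one_apply]
  ring

lemma sform_vecMul (g : Sp F n) (u v : Vec F n) :
    sform (u ᵥ* g.1) (v ᵥ* g.1) = sform u v := by
  rw [sform_eq, sform_eq, ← Matrix.mulVec_transpose g.1 v, Matrix.mulVec_mulVec,
    ← Matrix.dotProduct_mulVec, Matrix.mulVec_mulVec, ← Matrix.mul_assoc,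
    SymplecticGroup.mem_iff.1 g.2]

/-- The operator `∑ v, E (v)⁻¹ * E (v g)`, a nonzero solution `T` of
`E v * T = T * E (v g)` for all `v` (unique up to scalars). -/
def intertwiner (g : Sp F n) : Module.End ℂ (Schr F n) :=
  ∑ v : Vec F n, E (-v) * E (v ᵥ* g.1)

/-- Projection of functions on `F ^ n` to their even part. -/
def evenProj : Module.End ℂ (Schr F n) where
  toFun f t := (f t + f (-t)) / 2
  map_add' f g := by ext t; simp; ring
  map_smul' c f := by ext t; simp; ring

/-- Projection of functions on `F ^ n` to their odd part. -/
def oddProj : Module.End ℂ (Schr F n) where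
  toFun f t := (f t - f (-t)) / 2
  map_add' f g := by ext t; simp; ring
  map_smul' c f := by ext t; simp; ring

/-- For `T` preserving parity: the determinant of `T` on the even functions. -/
def detEven (T : Module.End ℂ (Schr F n)) : ℂ := LinearMap.det (T * evenProj + oddProj)

/-- For `T` preserving parity: the determinant of `T` on the odd functions. -/
def detOdd (T : Module.End ℂ (Schr F n)) : ℂ := LinearMap.det (T * oddProj + evenProj)

/-- The multiple of `intertwiner g` that has the same determinant on the even and on the odd
functions. As the dimensions of these two spaces differ by `1`, exactly one nonzero multiple
has this property. It is the Weil operator of `g`. -/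
def weilOperator (g : Sp F n) : Module.End ℂ (Schr F n) :=
  (detOdd (intertwiner g) / detEven (intertwiner g)) • intertwiner g

lemma E_mul_intertwiner (g : Sp F n) (u : Vec F n) :
    E u * intertwiner g = intertwiner g * E (u ᵥ* g.1) := by
  rw [intertwiner, Finset.mul_sum, Finset.sum_mul, ← Equiv.sum_comp (Equiv.addLeft u)]
  refine Finset.sum_congr rfl fun v _ => ?_
  simp only [Equiv.coe_addLeft]
  rw [mul_assoc, E_mul (v ᵥ* g.1), ← mul_assoc, E_mul u, Matrix.add_vecMul, smul_mul_assoc,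
    mul_smul_comm, add_comm (u ᵥ* g.1), sform_vecMul]
  have h : u + -(u + v) = -v := by abel
  rw [h]
  congr 2
  rw [sform_comm u, sform_neg_left, sform_add_left, sform_self, zero_add, neg_neg]

lemma two_ne_zero' (hF : ringChar F ≠ 2) : (2 : F) ≠ 0 := Ring.two_ne_zero hF

lemma exists_char_ne_one (hF : ringChar F ≠ 2) {a : Fin n → F} (ha : a ≠ 0) :
    ∃ x : Fin n → F, canonicalChar F (2 * (x ⬝ᵥ a)) ≠ 1 := by
  obtain ⟨i, hi⟩ := Function.ne_iff.1 ha
  obtain ⟨b, hb⟩ := exists_canonicalChar_ne_one F (mul_ne_zero (two_ne_zero' hF) hi)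
  refine ⟨Pi.single i b, ?_⟩
  rw [single_dotProduct]
  rwa [mul_left_comm] at hb

lemma E_inl (x t : Fin n → F) (f : Schr F n) :
    E (Sum.elim x 0) f t = canonicalChar F (2 * (x ⬝ᵥ t)) * f t := by
  rw [E_apply]
  simp

lemma E_inr (y t : Fin n → F) (f : Schr F n) : E (Sum.elim 0 y) f t = f (t - y) := by
  rw [E_apply]
  simp

open Classical in
/-- Schur's lemma for the Heisenberg operators. -/
lemma eq_smul_of_commute (hF : ringChar F ≠ 2) (T : Module.End ℂ (Schr F n))
    (hT : ∀ v, E v * T = T * E v) : ∃ c : ℂ, T = c • 1 := by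
  have hT' : ∀ v f t, E v (T f) t = T (E v f) t := fun v f t =>
    congrFun (LinearMap.congr_fun (hT v) f) t
  have h1 : ∀ a s : Fin n → F, s ≠ a → T (Pi.single a 1) s = 0 := by
    intro a s hsa
    obtain ⟨x, hx⟩ := exists_char_ne_one hF (sub_ne_zero.2 hsa)
    have h := hT' (Sum.elim x 0) (Pi.single a 1) s
    have h2 : E (Sum.elim x 0) (Pi.single a 1 : Schr F n) =
        canonicalChar F (2 * (x ⬝ᵥ a)) • (Pi.single a 1 : Schr F n) := by
      funext t
      rw [E_inl, Pi.smul_apply, smul_eq_mul]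
      by_cases hta : t = a
      · rw [hta]
      · simp [hta]
    rw [h2, E_inl, map_smul, Pi.smul_apply, smul_eq_mul] at h
    by_contra hne
    have h3 := mul_right_cancel₀ hne h
    apply hx
    rw [dotProduct_sub, mul_sub, sub_eq_add_neg, AddChar.map_add_eq_mul, h3,
      ← AddChar.map_add_eq_mul, add_neg_cancel, AddChar.map_zero_eq_one]
  have h2 : ∀ a : Fin n → F, T (Pi.single a 1) a = T (Pi.single 0 1) 0 := by
    intro a
    have h := hT' (Sum.elim 0 a) (Pi.single 0 1) a
    have h3 : E (Sum.elim 0 a) (Pi.single 0 1 : Schr F n) = Pi.single a 1 := by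
      funext t
      rw [E_inr]
      by_cases hta : t = a
      · simp [hta]
      · simp [hta, sub_eq_zero]
    rw [h3, E_inr, sub_self] at h
    exact h.symm
  refine ⟨T (Pi.single 0 1) 0, ?_⟩
  refine (Pi.basisFun ℂ (Fin n → F)).ext fun a => ?_
  funext s
  rw [Pi.basisFun_apply, LinearMap.smul_apply, Module.End.one_apply, Pi.smul_apply, smul_eq_mul]
  by_cases hsa : s = a
  · rw [hsa, h2]; simp
  · rw [h1 a s hsa]; simp [hsa]

open Classical in
lemma trace_E (hF : ringChar F ≠ 2) (v : Vec F n) :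
    LinearMap.trace ℂ _ (E v) = if v = 0 then (Fintype.card F : ℂ) ^ n else 0 := by
  split_ifs with hv
  · rw [hv, E_zero, LinearMap.trace_one]
    simp
  · -- conjugating by some `E u` multiplies `E v` by a scalar different from `1`
    have key : ∃ u : Vec F n, canonicalChar F (2 * sform u v) ≠ 1 := by
      by_cases h : v ∘ Sum.inr = 0
      · have h' : v ∘ Sum.inl ≠ 0 := by
          intro h'
          apply hv
          funext i
          rcases i with i | i
          · exact congrFun h' i
          · exact congrFun h i
        obtain ⟨x, hx⟩ := exists_char_ne_one hF (neg_ne_zero.2 h')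
        refine ⟨Sum.elim 0 x, ?_⟩
        simpa [sform] using hx
      · obtain ⟨x, hx⟩ := exists_char_ne_one hF h
        refine ⟨Sum.elim x 0, ?_⟩
        simpa [sform] using hx
    obtain ⟨u, hu⟩ := key
    have h1 : E u * E v * E (-u) = canonicalChar F (2 * sform u v) • E v := by
      rw [E_mul, smul_mul_assoc, E_mul, smul_smul, ← AddChar.map_add_eq_mul]
      have h2 : u + v + -u = v := by abel
      rw [h2]
      congr 2
      rw [sform_comm (u + v), sform_neg_left, neg_neg, sform_comm u (u + v), sform_add_left,
        sform_self, sform_comm v u]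
      ring
    have h3 := congrArg (LinearMap.trace ℂ _) h1
    rw [LinearMap.trace_mul_comm, ← mul_assoc, E_neg_mul, one_mul, map_smul, smul_eq_mul] at h3
    by_contra hne
    exact hu (mul_right_cancel₀ hne (by rw [← h3, one_mul]))

lemma trace_intertwiner_ne_zero (hF : ringChar F ≠ 2) (g : Sp F n) :
    LinearMap.trace ℂ _ (intertwiner g) ≠ 0 := by
  classical
  have h : LinearMap.trace ℂ _ (intertwiner g) =
      ∑ v : Vec F n, if v ᵥ* g.1 = v then (Fintype.card F : ℂ) ^ n else 0 := by
    rw [intertwiner, map_sum]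
    refine Finset.sum_congr rfl fun v _ => ?_
    rw [E_mul, map_smul, trace_E hF]
    by_cases hv : v ᵥ* g.1 = v
    · rw [hv, sform_neg_left, sform_self]; simp
    · rw [if_neg hv, if_neg (by rw [neg_add_eq_zero]; exact Ne.symm hv)]; simp
  rw [h, ← Finset.sum_filter, Finset.sum_const, nsmul_eq_mul]
  refine mul_ne_zero (Nat.cast_ne_zero.2 (Finset.card_ne_zero.2 ⟨0, ?_⟩))
    (pow_ne_zero _ (Nat.cast_ne_zero.2 Fintype.card_ne_zero))
  simp

lemma sum_conj_eq (hF : ringChar F ≠ 2) (A : Module.End ℂ (Schr F n)) :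
    ∃ c : ℂ, ∑ u : Vec F n, E (-u) * A * E u = c • 1 ∧
      (LinearMap.trace ℂ _ A ≠ 0 → c ≠ 0) := by
  obtain ⟨c, hc⟩ := eq_smul_of_commute hF (∑ u : Vec F n, E (-u) * A * E u) (by
    intro w
    rw [Finset.mul_sum, Finset.sum_mul, ← Equiv.sum_comp (Equiv.addRight w)]
    refine Finset.sum_congr rfl fun u _ => ?_
    simp only [Equiv.coe_addRight]
    rw [mul_assoc (E (-u) * A), E_mul u w, ← mul_assoc, ← mul_assoc, E_mul w, smul_mul_assoc,
      smul_mul_assoc, mul_smul_comm]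
    have h : w + -(u + w) = -u := by abel
    rw [h]
    congr 2
    rw [sform_comm w, sform_neg_left, sform_add_left, sform_self, add_zero, neg_neg])
  refine ⟨c, hc, fun hA hc0 => hA ?_⟩
  have h := congrArg (LinearMap.trace ℂ _) hc
  rw [hc0, zero_smul, map_zero, map_sum] at h
  have h2 : ∀ u : Vec F n, LinearMap.trace ℂ _ (E (-u) * A * E u) = LinearMap.trace ℂ _ A := by
    intro u
    rw [LinearMap.trace_mul_comm, ← mul_assoc, E_mul_neg, one_mul]
  rw [Finset.sum_congr rfl fun u _ => h2 u, Finset.sum_const, nsmul_eq_mul] at h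
  exact (mul_eq_zero.1 h).resolve_left (Nat.cast_ne_zero.2 Fintype.card_ne_zero)

lemma isUnit_intertwiner (hF : ringChar F ≠ 2) (g : Sp F n) : IsUnit (intertwiner g) := by
  obtain ⟨c, hc, hc0⟩ := sum_conj_eq hF (intertwiner g)
  have hc1 := hc0 (trace_intertwiner_ne_zero hF g)
  have h : intertwiner g * intertwiner g⁻¹ = c • 1 := by
    rw [← hc]
    conv_lhs => rw [intertwiner.eq_1 g⁻¹, Finset.mul_sum]
    let e : Vec F n ≃ Vec F n :=
      { toFun := fun v => v ᵥ* g.1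
        invFun := fun v => v ᵥ* (g⁻¹).1
        left_inv := fun v => by
          change v ᵥ* g.1 ᵥ* (g⁻¹).1 = v
          rw [Matrix.vecMul_vecMul, ← Submonoid.coe_mul, mul_inv_cancel]
          simp
        right_inv := fun v => by
          change v ᵥ* (g⁻¹).1 ᵥ* g.1 = v
          rw [Matrix.vecMul_vecMul, ← Submonoid.coe_mul, inv_mul_cancel]
          simp }
    rw [← Equiv.sum_comp e]
    refine Finset.sum_congr rfl fun v _ => ?_
    have h1 : e v = v ᵥ* g.1 := rfl
    have h2 : (v ᵥ* g.1) ᵥ* (g⁻¹).1 = v := e.left_inv v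
    rw [h1, h2, ← mul_assoc, ← Matrix.neg_vecMul, ← E_mul_intertwiner]
  have h' : intertwiner g * (c⁻¹ • intertwiner g⁻¹) = 1 := by
    rw [mul_smul_comm, h, smul_smul, inv_mul_cancel₀ hc1, one_smul]
  exact IsUnit.of_mul_eq_one _ h'

lemma eq_smul_intertwiner (hF : ringChar F ≠ 2) (g : Sp F n) (A : Module.End ℂ (Schr F n))
    (hA : ∀ v, E v * A = A * E (v ᵥ* g.1)) : ∃ c : ℂ, A = c • intertwiner g := by
  obtain ⟨U, hU⟩ := isUnit_intertwiner hF g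
  obtain ⟨c, hc⟩ := eq_smul_of_commute hF (A * (U⁻¹).val) (by
    intro v
    rw [← mul_assoc, hA, mul_assoc, mul_assoc]
    congr 1
    rw [Units.eq_inv_mul_iff_mul_eq, ← mul_assoc, Units.mul_inv_eq_iff_eq_mul, hU]
    exact (E_mul_intertwiner g v).symm)
  refine ⟨c, ?_⟩
  rw [Units.mul_inv_eq_iff_eq_mul] at hc
  rw [hc, hU, smul_mul_assoc, one_mul]

lemma evenProj_mul_evenProj : (evenProj * evenProj : Module.End ℂ (Schr F n)) = evenProj := by
  ext1 f; funext t; simp [evenProj]; ring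

lemma oddProj_mul_oddProj : (oddProj * oddProj : Module.End ℂ (Schr F n)) = oddProj := by
  ext1 f; funext t; simp [oddProj]; ring

lemma evenProj_mul_oddProj : (evenProj * oddProj : Module.End ℂ (Schr F n)) = 0 := by
  ext1 f; funext t; simp [evenProj, oddProj]; ring

lemma oddProj_mul_evenProj : (oddProj * evenProj : Module.End ℂ (Schr F n)) = 0 := by
  ext1 f; funext t; simp [evenProj, oddProj]; ring

lemma evenProj_add_oddProj : (evenProj + oddProj : Module.End ℂ (Schr F n)) = 1 := by
  ext1 f; funext t; simp [evenProj, oddProj]; ring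

lemma evenProj_sub_oddProj (f : Schr F n) (t : Fin n → F) :
    (evenProj - oddProj : Module.End ℂ (Schr F n)) f t = f (-t) := by
  simp [evenProj, oddProj]; ring

lemma parity_mul_E (v : Vec F n) :
    (evenProj - oddProj : Module.End ℂ (Schr F n)) * E v = E (-v) * (evenProj - oddProj) := by
  ext1 f
  funext t
  have h1 : (-v) ∘ Sum.inl = -(v ∘ Sum.inl) := rfl
  have h2 : (-v) ∘ Sum.inr = -(v ∘ Sum.inr) := rfl
  rw [Module.End.mul_apply, Module.End.mul_apply, evenProj_sub_oddProj, E_apply, E_apply,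
    evenProj_sub_oddProj, h1, h2]
  simp only [neg_dotProduct, dotProduct_neg, neg_neg, sub_neg_eq_add, neg_add_rev]
  rw [add_comm, sub_eq_add_neg, add_comm]
  congr 2
  abel

lemma evenProj_comm_intertwiner (g : Sp F n) :
    evenProj * intertwiner g = intertwiner g * evenProj := by
  have hP : (evenProj - oddProj) * intertwiner g = intertwiner g * (evenProj - oddProj) := by
    rw [intertwiner, Finset.mul_sum, Finset.sum_mul, ← Equiv.sum_comp (Equiv.neg _)]
    refine Finset.sum_congr rfl fun v _ => ?_
    simp only [Equiv.neg_apply]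
    rw [← mul_assoc, parity_mul_E, mul_assoc, parity_mul_E, Matrix.neg_vecMul, neg_neg, neg_neg,
      mul_assoc]
  have he : (evenProj : Module.End ℂ (Schr F n)) =
      (2⁻¹ : ℂ) • ((evenProj - oddProj) + 1) := by
    rw [← evenProj_add_oddProj]
    have : (evenProj - oddProj + (evenProj + oddProj) : Module.End ℂ (Schr F n)) =
        (2 : ℂ) • evenProj := by rw [two_smul]; abel
    rw [this, smul_smul]
    norm_num
  rw [he, smul_mul_assoc, mul_smul_comm, add_mul, mul_add, hP, one_mul, mul_one]

lemma oddProj_eq : (oddProj : Module.End ℂ (Schr F n)) = 1 - evenProj := by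
  rw [← evenProj_add_oddProj]; abel

lemma oddProj_comm {S : Module.End ℂ (Schr F n)} (hS : evenProj * S = S * evenProj) :
    oddProj * S = S * oddProj := by
  rw [oddProj_eq, sub_mul, mul_sub, hS, one_mul, mul_one]

lemma mul_proj_add_mul {R : Type*} [Ring R] {p r T S : R} (hp : p * p = p) (hr : r * r = r)
    (hpr : p * r = 0) (hrp : r * p = 0) (hS : p * S = S * p) :
    (T * p + r) * (S * p + r) = T * S * p + r := by
  calc (T * p + r) * (S * p + r)
      = T * (p * S) * p + T * (p * r) + r * S * p + r * r := by noncomm_ring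
    _ = T * S * (p * p) + r * S * p + r := by rw [hS, hpr, hr]; noncomm_ring
    _ = T * S * p + r * (p * S) + r := by rw [hp, hS]; noncomm_ring
    _ = T * S * p + r := by rw [← mul_assoc, hrp, zero_mul, add_zero]

lemma detEven_mul (T S : Module.End ℂ (Schr F n)) (hS : evenProj * S = S * evenProj) :
    detEven (T * S) = detEven T * detEven S := by
  rw [detEven, detEven, detEven, ← map_mul, mul_proj_add_mul evenProj_mul_evenProj
    oddProj_mul_oddProj evenProj_mul_oddProj oddProj_mul_evenProj hS]

lemma detOdd_mul (T S : Module.End ℂ (Schr F n)) (hS : evenProj * S = S * evenProj) :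
    detOdd (T * S) = detOdd T * detOdd S := by
  rw [detOdd, detOdd, detOdd, ← map_mul, mul_proj_add_mul oddProj_mul_oddProj
    evenProj_mul_evenProj oddProj_mul_evenProj evenProj_mul_oddProj (oddProj_comm hS)]

lemma isIdempotentElem_evenProj : IsIdempotentElem (evenProj : Module.End ℂ (Schr F n)) :=
  evenProj_mul_evenProj

lemma isIdempotentElem_oddProj : IsIdempotentElem (oddProj : Module.End ℂ (Schr F n)) :=
  oddProj_mul_oddProj

/-- `det` of `c p + (1 - p)` for a projection `p`. -/
lemma det_smul_add {H : Type*} [AddCommGroup H] [Module ℂ H] [FiniteDimensional ℂ H]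
    (p r : Module.End ℂ H) (hp : IsIdempotentElem p) (hr : r = 1 - p) (c : ℂ) :
    LinearMap.det (c • p + r) = c ^ Module.finrank ℂ (LinearMap.range p) := by
  have hcompl := LinearMap.IsIdempotentElem.isCompl hp
  let e := Submodule.prodEquivOfIsCompl _ _ hcompl
  have h : c • p + r = (e : _ →ₗ[ℂ] H) ∘ₗ (LinearMap.prodMap (c • LinearMap.id) LinearMap.id) ∘ₗ
      (e.symm : H →ₗ[ℂ] (LinearMap.range p × LinearMap.ker p)) := by
    refine LinearMap.ext fun x => ?_
    obtain ⟨⟨⟨_, b, rfl⟩, ⟨k, hk⟩⟩, rfl⟩ := e.surjective x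
    have hk' : p k = 0 := hk
    have hpb : p (p b) = p b := LinearMap.congr_fun hp b
    rw [LinearMap.comp_apply, LinearMap.comp_apply, LinearEquiv.coe_coe, LinearEquiv.coe_coe,
      e.symm_apply_apply]
    simp [e, hr, hk', hpb, -Submodule.coe_prodEquivOfIsCompl]
  rw [h, LinearMap.det_conj]
  rw [LinearMap.det_prodMap]
  simp

lemma finrank_range_evenProj (hF : ringChar F ≠ 2) :
    Module.finrank ℂ (LinearMap.range (evenProj : Module.End ℂ (Schr F n))) =
      Module.finrank ℂ (LinearMap.range (oddProj : Module.End ℂ (Schr F n))) + 1 := by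
  classical
  have h1 := (LinearMap.IsIdempotentElem.isProj_range _
    (isIdempotentElem_evenProj (F := F) (n := n))).trace
  have h2 := (LinearMap.IsIdempotentElem.isProj_range _
    (isIdempotentElem_oddProj (F := F) (n := n))).trace
  have h3 : LinearMap.trace ℂ _ (evenProj - oddProj : Module.End ℂ (Schr F n)) = 1 := by
    rw [LinearMap.trace_eq_matrix_trace ℂ (Pi.basisFun ℂ (Fin n → F)), Matrix.trace,
      Finset.sum_eq_single 0]
    · rw [Matrix.diag_apply, LinearMap.toMatrix_apply, Pi.basisFun_repr, evenProj_sub_oddProj]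
      simp
    · intro t _ ht
      rw [Matrix.diag_apply, LinearMap.toMatrix_apply, Pi.basisFun_repr, evenProj_sub_oddProj,
        Pi.basisFun_apply, Pi.single_eq_of_ne]
      intro h
      apply ht
      funext i
      have hi : -t i = t i := congrFun h i
      have h4 : (2 : F) * t i = 0 := by linear_combination -hi
      exact (mul_eq_zero.1 h4).resolve_left (two_ne_zero' hF)
    · simp
  rw [map_sub, h1, h2, sub_eq_iff_eq_add, add_comm] at h3
  exact_mod_cast h3

lemma detEven_smul (c : ℂ) (T : Module.End ℂ (Schr F n)) :
    detEven (c • T) =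
      c ^ Module.finrank ℂ (LinearMap.range (evenProj : Module.End ℂ (Schr F n))) *
        detEven T := by
  have h : evenProj * (c • 1 : Module.End ℂ (Schr F n)) = (c • 1) * evenProj := by simp
  have h2 : c • T = T * (c • 1) := by simp
  rw [h2, detEven_mul _ _ h, mul_comm]
  congr 1
  rw [detEven, smul_mul_assoc, one_mul]
  exact det_smul_add _ _ isIdempotentElem_evenProj oddProj_eq c

lemma detOdd_smul (c : ℂ) (T : Module.End ℂ (Schr F n)) :
    detOdd (c • T) =
      c ^ Module.finrank ℂ (LinearMap.range (oddProj : Module.End ℂ (Schr F n))) *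
        detOdd T := by
  have h : evenProj * (c • 1 : Module.End ℂ (Schr F n)) = (c • 1) * evenProj := by simp
  have h2 : c • T = T * (c • 1) := by simp
  rw [h2, detOdd_mul _ _ h, mul_comm]
  congr 1
  rw [detOdd, smul_mul_assoc, one_mul]
  refine det_smul_add _ _ isIdempotentElem_oddProj ?_ c
  rw [oddProj_eq]; abel

lemma isUnit_of_comm {T : Module.End ℂ (Schr F n)} (hT : IsUnit T)
    (h : evenProj * T = T * evenProj) : detEven T ≠ 0 ∧ detOdd T ≠ 0 := by
  obtain ⟨U, rfl⟩ := hT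
  have h' : evenProj * (U⁻¹).val = (U⁻¹).val * evenProj := by
    rw [Units.eq_inv_mul_iff_mul_eq, ← mul_assoc, Units.mul_inv_eq_iff_eq_mul]
    exact h.symm
  have h1 : detEven (1 : Module.End ℂ (Schr F n)) = 1 := by
    rw [detEven, one_mul, evenProj_add_oddProj, map_one]
  have h2 : detOdd (1 : Module.End ℂ (Schr F n)) = 1 := by
    rw [detOdd, one_mul, add_comm, evenProj_add_oddProj, map_one]
  constructor
  · intro h0
    have := detEven_mul (U : Module.End ℂ (Schr F n)) _ h'
    rw [h0, Units.mul_inv, h1, zero_mul] at this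
    exact one_ne_zero this
  · intro h0
    have := detOdd_mul (U : Module.End ℂ (Schr F n)) _ h'
    rw [h0, Units.mul_inv, h2, zero_mul] at this
    exact one_ne_zero this

lemma detEven_ne_zero (hF : ringChar F ≠ 2) (g : Sp F n) : detEven (intertwiner g) ≠ 0 :=
  (isUnit_of_comm (isUnit_intertwiner hF g) (evenProj_comm_intertwiner g)).1

lemma detOdd_ne_zero (hF : ringChar F ≠ 2) (g : Sp F n) : detOdd (intertwiner g) ≠ 0 :=
  (isUnit_of_comm (isUnit_intertwiner hF g) (evenProj_comm_intertwiner g)).2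

/-- The defining property of the Weil operators. -/
lemma E_mul_weilOperator (g : Sp F n) (v : Vec F n) :
    E v * weilOperator g = weilOperator g * E (v ᵥ* g.1) := by
  rw [weilOperator, mul_smul_comm, smul_mul_assoc, E_mul_intertwiner]

/-- Every nonzero solution of the intertwining equations normalizes to the Weil operator. -/
lemma eq_weilOperator (hF : ringChar F ≠ 2) (g : Sp F n) (A : Module.End ℂ (Schr F n))
    (hA : ∀ v, E v * A = A * E (v ᵥ* g.1)) (hA0 : A ≠ 0) :
    (detOdd A / detEven A) • A = weilOperator g := by
  obtain ⟨c, rfl⟩ := eq_smul_intertwiner hF g A hA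
  have hc : c ≠ 0 := by
    rintro rfl
    simp at hA0
  have h1 := detEven_ne_zero hF g
  rw [detEven_smul, detOdd_smul, weilOperator, smul_smul, finrank_range_evenProj hF, pow_succ]
  congr 1
  field_simp

lemma weilOperator_one (hF : ringChar F ≠ 2) : weilOperator (1 : Sp F n) = 1 := by
  rw [← eq_weilOperator hF 1 1 (by simp) (isUnit_one (M := Module.End ℂ (Schr F n))).ne_zero]
  have h1 : detEven (1 : Module.End ℂ (Schr F n)) = 1 := by
    rw [detEven, one_mul, evenProj_add_oddProj, map_one]
  have h2 : detOdd (1 : Module.End ℂ (Schr F n)) = 1 := by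
    rw [detOdd, one_mul, add_comm, evenProj_add_oddProj, map_one]
  rw [h1, h2, div_one, one_smul]

lemma weilOperator_mul (hF : ringChar F ≠ 2) (g h : Sp F n) :
    weilOperator (g * h) = weilOperator g * weilOperator h := by
  rw [← eq_weilOperator hF (g * h) (intertwiner g * intertwiner h), detEven_mul, detOdd_mul,
    weilOperator, weilOperator, smul_mul_smul_comm, mul_div_mul_comm]
  · exact evenProj_comm_intertwiner h
  · exact evenProj_comm_intertwiner h
  · intro v
    rw [← mul_assoc, E_mul_intertwiner, mul_assoc, E_mul_intertwiner, ← mul_assoc,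
      Matrix.vecMul_vecMul]
    rfl
  · exact ((isUnit_intertwiner hF g).mul (isUnit_intertwiner hF h)).ne_zero

/-- The Weil representation of `Sp(2n, q)`, `q` odd, on the functions on `F ^ n`: the
representation with `E v * W g = W g * E (v g)` for all `v`, normalized so that each `W g` has the
same determinant on the even and on the odd functions. (The normalization only matters for
`Sp(2, 3)`; all other groups `Sp(2n, q)` are perfect, and both determinants are `1`.) -/
def weilRep (F : Type*) [Field F] [Fintype F] (n : ℕ) (hF : ringChar F ≠ 2) :
    Representation ℂ (Sp F n) (Schr F n) where
  toFun := weilOperator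
  map_one' := weilOperator_one hF
  map_mul' := weilOperator_mul hF

/-- The Weil character `ω`. -/
def weilChar (F : Type*) [Field F] [Fintype F] (n : ℕ) (hF : ringChar F ≠ 2) : Sp F n → ℂ :=
  (weilRep F n hF).character

/-- `ω₊` and `ω₋` are irreducible characters of degrees `(q ^ n + 1) / 2` and `(q ^ n - 1) / 2`
with `ω = ω₊ + ω₋`. -/
structure AreWeilConstituents (hF : ringChar F ≠ 2) (ωp ωm : Sp F n → ℂ) : Prop where
  irreducible_plus : IsIrreducibleCharacter ωp
  irreducible_minus : IsIrreducibleCharacter ωm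
  degree_plus : ωp 1 = ((Fintype.card F : ℂ) ^ n + 1) / 2
  degree_minus : ωm 1 = ((Fintype.card F : ℂ) ^ n - 1) / 2
  weilChar_eq : weilChar F n hF = ωp + ωm

end WeilRepresentation

/-! ### The subgroups `B` and `G` and their linear characters -/

section Subgroups

variable {F : Type*} [Field F] {n : ℕ}

lemma lower_mem {Q : Matrix (Fin n) (Fin n) F} (hQ : Q.IsSymm) :
    Matrix.fromBlocks 1 0 Q 1 ∈ Matrix.symplecticGroup (Fin n) F := by
  rw [SymplecticGroup.fromBlocks_mem_iff]
  simp [hQ.eq]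

/-- The symplectic matrix `g_Q` with rows `(I, 0)` and `(Q, I)`, for `Q` symmetric. -/
def lower (Q : Matrix (Fin n) (Fin n) F) (hQ : Q.IsSymm) : Sp F n :=
  ⟨Matrix.fromBlocks 1 0 Q 1, lower_mem hQ⟩

/-- The central element `-I` of `Sp(2n, F)`. -/
def negOne (F : Type*) [Field F] (n : ℕ) : Sp F n :=
  ⟨-1, SymplecticGroup.neg_mem (one_mem _)⟩

lemma lower_zero : lower (0 : Matrix (Fin n) (Fin n) F) Matrix.isSymm_zero = 1 := by
  ext1
  exact Matrix.fromBlocks_one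

lemma lower_mul {Q R : Matrix (Fin n) (Fin n) F} (hQ : Q.IsSymm) (hR : R.IsSymm) :
    lower Q hQ * lower R hR = lower (Q + R) (hQ.add hR) := by
  ext1
  simp [lower, Matrix.fromBlocks_multiply]

/-- The subgroup `B` of all `g_Q`, with `Q` symmetric. -/
def subgroupB (F : Type*) [Field F] (n : ℕ) : Subgroup (Sp F n) where
  carrier := {g | ∃ (Q : Matrix (Fin n) (Fin n) F) (hQ : Q.IsSymm), g = lower Q hQ}
  one_mem' := ⟨0, Matrix.isSymm_zero, lower_zero.symm⟩
  mul_mem' := by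
    rintro _ _ ⟨Q, hQ, rfl⟩ ⟨R, hR, rfl⟩
    exact ⟨Q + R, hQ.add hR, lower_mul hQ hR⟩
  inv_mem' := by
    rintro _ ⟨Q, hQ, rfl⟩
    refine ⟨-Q, hQ.neg, ?_⟩
    rw [inv_eq_iff_mul_eq_one, lower_mul, ← lower_zero]
    congr 1
    exact add_neg_cancel Q

/-- The subgroup `G = ⟨-I⟩ × B`. -/
def subgroupG (F : Type*) [Field F] (n : ℕ) : Subgroup (Sp F n) :=
  Subgroup.zpowers (negOne F n) ⊔ subgroupB F n

open Classical in
/-- The linear character `λ_S^ε` of `G`, where `ε` is `1` or `-1`: its value at `g_Q` is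
`ψ(Tr (S Q))`, and its value at `-g_Q` is `ε ψ(Tr (S Q))`. (The lower left blocks of `g_Q` and
`-g_Q` are `Q` and `-Q`.) -/
def lam [Finite F] (ε : ℤ) (S : Matrix (Fin n) (Fin n) F) (g : subgroupG F n) : ℂ :=
  if g.1 ∈ subgroupB F n then
    canonicalChar F (S * g.1.1.toBlocks₂₁).trace
  else
    ε * canonicalChar F (S * -g.1.1.toBlocks₂₁).trace

lemma lower_mem_subgroupB (Q : Matrix (Fin n) (Fin n) F) (hQ : Q.IsSymm) :
    lower Q hQ ∈ subgroupB F n := ⟨Q, hQ, rfl⟩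

lemma lower_mem_subgroupG (Q : Matrix (Fin n) (Fin n) F) (hQ : Q.IsSymm) :
    lower Q hQ ∈ subgroupG F n := Subgroup.mem_sup_right (lower_mem_subgroupB Q hQ)

lemma neg_lower_mem_subgroupG (Q : Matrix (Fin n) (Fin n) F) (hQ : Q.IsSymm) :
    negOne F n * lower Q hQ ∈ subgroupG F n :=
  mul_mem (Subgroup.mem_sup_left (Subgroup.mem_zpowers _)) (lower_mem_subgroupG Q hQ)

lemma lam_lower [Finite F] (ε : ℤ) (S Q : Matrix (Fin n) (Fin n) F) (hQ : Q.IsSymm) :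
    lam ε S ⟨lower Q hQ, lower_mem_subgroupG Q hQ⟩ = canonicalChar F (S * Q).trace := by
  rw [lam, if_pos (lower_mem_subgroupB Q hQ)]
  simp [lower]

lemma lam_neg_lower [Finite F] (hF : ringChar F ≠ 2) (hn : 1 ≤ n) (ε : ℤ)
    (S Q : Matrix (Fin n) (Fin n) F) (hQ : Q.IsSymm) :
    lam ε S ⟨negOne F n * lower Q hQ, neg_lower_mem_subgroupG Q hQ⟩ =
      ε * canonicalChar F (S * Q).trace := by
  have h : (negOne F n * lower Q hQ).1 = Matrix.fromBlocks (-1) 0 (-Q) (-1) := by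
    change -1 * Matrix.fromBlocks 1 0 Q 1 = _
    rw [neg_one_mul, Matrix.fromBlocks_neg, neg_zero]
  rw [lam, if_neg]
  · simp only [h, Matrix.toBlocks_fromBlocks₂₁, neg_neg]
  · rintro ⟨R, hR, hR'⟩
    have h2 := congrArg Subtype.val hR'
    rw [h] at h2
    have h3 := congrFun (congrFun (Matrix.fromBlocks_inj.1 h2).1 ⟨0, hn⟩) ⟨0, hn⟩
    simp only [Matrix.neg_apply, Matrix.one_apply_eq] at h3
    exact Ring.neg_one_ne_one_of_char_ne_two hF h3

end Subgroups

/-! ### The invariant `Δ` of a symmetric matrix -/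

section Discriminant

variable {F : Type*} [Field F] {n : ℕ}

/-- `P` and `d` diagonalize the quadratic form with matrix `Q`. -/
def Diagonalizes (P : Matrix (Fin n) (Fin n) F) (d : Fin n → F) (Q : Matrix (Fin n) (Fin n) F) :
    Prop :=
  IsUnit P.det ∧ P * Q * Pᵀ = Matrix.diagonal d

lemma exists_diagonalizes (hF : ringChar F ≠ 2) {Q : Matrix (Fin n) (Fin n) F}
    (hQ : Q.IsSymm) : ∃ Pd : Matrix (Fin n) (Fin n) F × (Fin n → F),
      Diagonalizes Pd.1 Pd.2 Q := by
  let _ : Invertible (2 : F) := invertibleOfNonzero (Ring.two_ne_zero hF)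
  have hB : LinearMap.IsSymm (Matrix.toBilin' Q) := by
    rw [← LinearMap.BilinForm.isSymm_iff]
    refine ⟨fun x y => ?_⟩
    rw [Matrix.toBilin'_apply', Matrix.toBilin'_apply', Matrix.dotProduct_mulVec,
      dotProduct_comm, ← Matrix.mulVec_transpose, hQ.eq]
  obtain ⟨v, hv⟩ := LinearMap.BilinForm.exists_orthogonal_basis hB
  let w := v.reindex (finCongr (Module.finrank_fin_fun F))
  have hw : ∀ i j, i ≠ j → Matrix.toBilin' Q (w i) (w j) = 0 := by
    intro i j hij
    simp only [w, Module.Basis.reindex_apply]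
    exact hv (by simpa using hij)
  refine ⟨(((Pi.basisFun F (Fin n)).toMatrix w)ᵀ, fun i => Matrix.toBilin' Q (w i) (w i)), ?_, ?_⟩
  · rw [Matrix.det_transpose]
    exact Matrix.isUnit_det_of_right_inverse
      (Module.Basis.toMatrix_mul_toMatrix_flip (Pi.basisFun F (Fin n)) w)
  · have h : ∀ i j, ((((Pi.basisFun F (Fin n)).toMatrix w)ᵀ * Q *
        (((Pi.basisFun F (Fin n)).toMatrix w)ᵀ)ᵀ) i j) = Matrix.toBilin' Q (w i) (w j) := by
      intro i j
      rw [Matrix.toBilin'_apply', Matrix.mul_assoc]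
      simp only [Matrix.mul_apply, dotProduct, Matrix.mulVec, Matrix.transpose_apply,
        Module.Basis.toMatrix_apply, Pi.basisFun_repr]
    ext i j
    rw [h]
    by_cases hij : i = j
    · rw [hij, Matrix.diagonal_apply_eq]
    · rw [hw i j hij, Matrix.diagonal_apply_ne _ hij]

open Classical in
/-- `Δ(Q) = χ(product of the nonzero entries of a diagonalization of Q)` for `Q` symmetric, where
`χ` is the quadratic character of `F`. The value does not depend on the diagonalization. An empty
product is `1`, so `Δ(0) = 1`. -/
def Delta [Fintype F] (Q : Matrix (Fin n) (Fin n) F) : ℤ :=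
  if h : ∃ Pd : Matrix (Fin n) (Fin n) F × (Fin n → F), Diagonalizes Pd.1 Pd.2 Q then
    quadraticChar F (∏ i with h.choose.2 i ≠ 0, h.choose.2 i)
  else 0

/-- `δ = χ(-1)`. -/
def delta (F : Type*) [Field F] [Fintype F] : ℤ :=
  open Classical in quadraticChar F (-1)

open Classical in
/-- The symmetric matrices `S` of rank `1` with `Δ(S) = δ`. -/
def rankOneSet (F : Type*) [Field F] [Fintype F] (n : ℕ) : Finset (Matrix (Fin n) (Fin n) F) :=
  {S | S.IsSymm ∧ S.rank = 1 ∧ Delta S = delta F}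

end Discriminant

end Weil

end

noncomputable section

namespace Weil

set_option linter.unusedSectionVars false

/-! ### Weil operators of some symplectic matrices -/

section

variable {F : Type*} [Field F] [Fintype F] {n : ℕ}

/-! The parity f(t) ↦ f(-t) commutes with all Weil operators, so W splits into its even and odd
parts, of dimensions (q^n + 1)/2 and (q^n - 1)/2. By `eq_weilOperator`, a Weil operator is known
once some nonzero solution of the intertwining equations and its determinants on the two parts are
known. This gives two explicit operators: W(g_Q) is multiplication by ψ(-tQtᵀ)
(`weilOperator_lower`), and W(-I) is δ^n times the parity operator (`weilOperator_negOne`).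

Restriction to G: on the functions of parity ε, multiplication by a has trace (1+ε)/2 · a(0) plus
half the sum of a(t) over t ≠ 0. Here a(t) = ψ(Tr(SQ)) with S = -tᵀt for the row vector t. The
vectors t and -t give the same S, which cancels the half, and the matrices S obtained are exactly
those of rank 1 with Δ(S) = δ (`mem_rankOneSet_iff`). As -I acts by the scalar εδ^n, the linear
characters that occur are λ_S with sign εδ^n.

Irreducibility (`mem_of_parityProj_eq`): averaging over B cuts any function in an invariant subspace
down to a pair {t, -t}, because t ↦ tᵀt separates such pairs. The Fourier transform, a multiple of
W(J), then carries one pair to all the others.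

The two parts are therefore irreducible of different degrees, and orthogonality of characters
identifies them with any given ω₊ and ω₋ (`AreWeilConstituents.eq_parityChar`). Multiplicity
freeness on B holds because distinct symmetric S give distinct characters of B (`lamB_injOn`). -/

/-- Projection to the functions `f` with `f (-t) = ε f t`, for `ε = ±1`. -/
def parityProj (ε : ℤ) : Module.End ℂ (Schr F n) where
  toFun f t := (f t + ε * f (-t)) / 2
  map_add' f g := by ext t; simp; ring
  map_smul' c f := by ext t; simp; ring

lemma parityProj_apply (ε : ℤ) (f : Schr F n) (t : Fin n → F) :
    parityProj ε f t = (f t + ε * f (-t)) / 2 := rfl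

lemma parityProj_one : (parityProj 1 : Module.End ℂ (Schr F n)) = evenProj := by
  ext1 f; funext t; simp [parityProj, evenProj]

lemma parityProj_neg_one : (parityProj (-1) : Module.End ℂ (Schr F n)) = oddProj := by
  ext1 f; funext t; simp [parityProj, oddProj, sub_eq_add_neg]

/-! ### Multiplication operators and the elements g_Q -/

/-- The operator of multiplication by a function on `F ^ n`. -/
def mulOp (a : Schr F n) : Module.End ℂ (Schr F n) := LinearMap.mulLeft ℂ a

lemma mulOp_apply (a f : Schr F n) (t : Fin n → F) : mulOp a f t = a t * f t := rfl

lemma dotProduct_mulVec_comm {Q : Matrix (Fin n) (Fin n) F} (hQ : Q.IsSymm) (s t : Fin n → F) :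
    s ⬝ᵥ Q *ᵥ t = t ⬝ᵥ Q *ᵥ s := by
  rw [Matrix.dotProduct_mulVec, dotProduct_comm, ← Matrix.mulVec_transpose, hQ.eq]

lemma E_mul_mulOp {Q : Matrix (Fin n) (Fin n) F} (hQ : Q.IsSymm) (v : Vec F n) :
    E v * mulOp (fun t => canonicalChar F (-(t ⬝ᵥ Q *ᵥ t))) =
      mulOp (fun t => canonicalChar F (-(t ⬝ᵥ Q *ᵥ t))) * E (v ᵥ* (lower Q hQ).1) := by
  ext1 f
  funext t
  have h1 : (v ᵥ* (lower Q hQ).1) ∘ Sum.inl = v ∘ Sum.inl + (v ∘ Sum.inr) ᵥ* Q := by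
    simp [lower, Matrix.vecMul_fromBlocks]
  have h2 : (v ᵥ* (lower Q hQ).1) ∘ Sum.inr = v ∘ Sum.inr := by
    simp [lower, Matrix.vecMul_fromBlocks]
  simp only [Module.End.mul_apply, E_apply, mulOp_apply, h1, h2]
  rw [← mul_assoc, ← mul_assoc, ← AddChar.map_add_eq_mul, ← AddChar.map_add_eq_mul]
  congr 2
  simp only [Matrix.mulVec_sub, sub_dotProduct, dotProduct_sub, add_dotProduct,
    ← Matrix.dotProduct_mulVec]
  rw [dotProduct_mulVec_comm hQ t (v ∘ Sum.inr)]
  ring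

/-- An odd sign function on `F ^ n`. -/
def oddSign (t : Fin n → F) : ℤ :=
  -- An arbitrary enumeration of F^n decides which of t and -t counts as positive.
  SignType.sign ((Fintype.equivFin (Fin n → F) t : ℤ) - Fintype.equivFin (Fin n → F) (-t))

lemma oddSign_neg (t : Fin n → F) : oddSign (-t) = -oddSign t := by
  rw [oddSign, oddSign, neg_neg, ← neg_sub, Left.sign_neg]
  simp

lemma neg_eq_self_iff' (hF : ringChar F ≠ 2) (t : Fin n → F) : -t = t ↔ t = 0 := by
  refine ⟨fun h => ?_, fun h => by simp [h]⟩
  funext i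
  have hi : -t i = t i := congrFun h i
  have h4 : (2 : F) * t i = 0 := by linear_combination -hi
  exact (mul_eq_zero.1 h4).resolve_left (two_ne_zero' hF)

lemma oddSign_mul_self (hF : ringChar F ≠ 2) {t : Fin n → F} (ht : t ≠ 0) :
    oddSign t * oddSign t = 1 := by
  have h : ((Fintype.equivFin (Fin n → F) t : ℤ) - Fintype.equivFin (Fin n → F) (-t)) ≠ 0 := by
    intro h
    apply ht
    rw [← neg_eq_self_iff' hF]
    apply (Fintype.equivFin (Fin n → F)).injective
    apply Fin.ext
    omega
  rw [oddSign]
  rcases lt_or_gt_of_ne h with h | h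
  · simp [sign_neg h]
  · simp [sign_pos h]

open Classical in
/-- Multiplication by a function with value `1` at `0` has equal determinants on the even
and on the odd functions. -/
lemma detOdd_mulOp_eq (hF : ringChar F ≠ 2) (a : Schr F n)
    (ha0 : a 0 = 1) : detOdd (mulOp a) = detEven (mulOp a) := by
  -- The involution r exchanges the odd functions with the even functions vanishing at 0, and it
  -- commutes with multiplication by a. What remains of the even functions is the value at 0, where
  -- a is 1.
  let r : Schr F n := fun t => if t = 0 then 1 else oddSign t
  have hr : ∀ t, r t * r t = 1 := by
    intro t
    by_cases ht : t = 0
    · simp [r, ht]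
    · simp only [r, if_neg ht]
      exact_mod_cast oddSign_mul_self hF ht
  have hr2 : mulOp r * mulOp r = 1 := by
    refine LinearMap.ext fun f => funext fun t => ?_
    simp [mulOp_apply, ← mul_assoc, hr]
  have key : (mulOp r * (mulOp a * oddProj + evenProj)) * mulOp r =
      mulOp a * evenProj + oddProj := by
    refine LinearMap.ext fun f => funext fun t => ?_
    simp only [Module.End.mul_apply, LinearMap.add_apply, Pi.add_apply, mulOp_apply, evenProj,
      oddProj, LinearMap.coe_mk, AddHom.coe_mk]
    by_cases ht : t = 0
    · simp [ht, r, ha0]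
    · have hn : r (-t) = -r t := by
        simp [r, ht, oddSign_neg]
      rw [hn]
      linear_combination ((a t * (f t + f (-t)) + (f t - f (-t)))/2) * hr t
  rw [detOdd, detEven, ← key, map_mul, map_mul, mul_comm (LinearMap.det (mulOp r)), mul_assoc,
    ← map_mul, hr2, map_one, mul_one]

/-- The multiplication operator solves the intertwining equations by `E_mul_mulOp`, and its value 1
at t = 0 makes the normalizing quotient of determinants equal to 1. -/
lemma weilOperator_lower (hF : ringChar F ≠ 2) {Q : Matrix (Fin n) (Fin n) F} (hQ : Q.IsSymm) :
    weilOperator (lower Q hQ) = mulOp (fun t => canonicalChar F (-(t ⬝ᵥ Q *ᵥ t))) := by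
  have hev : evenProj * mulOp (fun t => canonicalChar F (-(t ⬝ᵥ Q *ᵥ t))) =
      mulOp (fun t => canonicalChar F (-(t ⬝ᵥ Q *ᵥ t))) * evenProj := by
    ext1 f; funext t
    simp only [Module.End.mul_apply, mulOp_apply, evenProj, LinearMap.coe_mk, AddHom.coe_mk,
      Matrix.mulVec_neg, neg_dotProduct, dotProduct_neg, neg_neg]
    ring
  have hu : IsUnit (mulOp (fun t : Fin n → F => canonicalChar F (-(t ⬝ᵥ Q *ᵥ t)))) := by
    refine IsUnit.of_mul_eq_one (mulOp (fun t => canonicalChar F (t ⬝ᵥ Q *ᵥ t))) ?_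
    ext1 f; funext t
    rw [Module.End.mul_apply, mulOp_apply, mulOp_apply, ← mul_assoc, ← AddChar.map_add_eq_mul]
    simp
  rw [← eq_weilOperator hF _ _ (E_mul_mulOp hQ) hu.ne_zero, detOdd_mulOp_eq hF, div_self, one_smul]
  · exact (isUnit_of_comm hu hev).1
  · simp

/-! ### The element -I -/

lemma finrank_parity (hF : ringChar F ≠ 2) :
    2 * Module.finrank ℂ (LinearMap.range (oddProj : Module.End ℂ (Schr F n))) + 1 =
      Fintype.card F ^ n := by
  have h := LinearMap.IsIdempotentElem.isCompl (isIdempotentElem_oddProj (F := F) (n := n))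
  have h1 := Submodule.finrank_add_eq_of_isCompl
    (LinearMap.IsIdempotentElem.isCompl (isIdempotentElem_evenProj (F := F) (n := n)))
  have h2 : LinearMap.ker (evenProj : Module.End ℂ (Schr F n)) = LinearMap.range oddProj := by
    rw [oddProj_eq, LinearMap.IsIdempotentElem.range_eq_ker
      (p := (1 - evenProj : Module.End ℂ (Schr F n))) (by
        exact isIdempotentElem_evenProj.one_sub)]
    congr 1
    change evenProj = 1 - (1 - evenProj)
    abel
  rw [h2, finrank_range_evenProj hF, Module.finrank_fintype_fun_eq_card, Fintype.card_fun,
    Fintype.card_fin] at h1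
  omega

/-- The odd functions have dimension (q^n - 1)/2, which is congruent to n(q - 1)/2 modulo 2, while δ
= (-1)^((q-1)/2). -/
lemma delta_pow (hF : ringChar F ≠ 2) :
    (-1 : ℤ) ^ Module.finrank ℂ (LinearMap.range (oddProj : Module.End ℂ (Schr F n))) =
      delta F ^ n := by
  classical
  set d := Module.finrank ℂ (LinearMap.range (oddProj : Module.End ℂ (Schr F n))) with hd
  have h := finrank_parity (F := F) (n := n) hF
  rw [← hd] at h
  have hδ : delta F = (-1) ^ (Fintype.card F / 2) := by
    rw [delta, quadraticChar_neg_one hF, ZMod.χ₄_eq_neg_one_pow (FiniteField.odd_card_of_char_ne_two hF)]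
  have hodd := FiniteField.odd_card_of_char_ne_two hF
  obtain ⟨m, hm⟩ : ∃ m, Fintype.card F = 2 * m + 1 := ⟨Fintype.card F / 2, by omega⟩
  have hm2 : Fintype.card F / 2 = m := by omega
  rw [hδ, hm2, ← pow_mul]
  rw [hm] at h
  clear_value d
  have key : ∀ n : ℕ, ∃ k, (2 * m + 1) ^ n = 2 * (m * n + 2 * k) + 1 := by
    intro n
    induction n with
    | zero => exact ⟨0, by simp⟩
    | succ n ih =>
      obtain ⟨k, hk⟩ := ih
      refine ⟨k + m * (m * n + 2 * k) , ?_⟩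
      rw [pow_succ, hk]
      ring
  obtain ⟨k, hk⟩ := key n
  have : d = m * n + 2 * k := by omega
  rw [this, pow_add, pow_mul _ 2 k]
  simp

lemma E_mul_parity (v : Vec F n) :
    E v * (evenProj - oddProj) = (evenProj - oddProj) * E (v ᵥ* (negOne F n).1) := by
  have h : v ᵥ* (negOne F n).1 = -v := by
    simp [negOne, Matrix.vecMul_neg]
  rw [h, parity_mul_E, neg_neg]

/-- The parity operator has determinant 1 on the even functions and (-1)^d on the odd ones, d being
their dimension; the quotient of the two is δ^n. -/
lemma weilOperator_negOne (hF : ringChar F ≠ 2) :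
    weilOperator (negOne F n) = (delta F ^ n : ℂ) • (evenProj - oddProj) := by
  have hP2 : (evenProj - oddProj) * (evenProj - oddProj) = (1 : Module.End ℂ (Schr F n)) := by
    ext1 f; funext t
    rw [Module.End.mul_apply, evenProj_sub_oddProj, evenProj_sub_oddProj]
    simp
  have hE : detEven (evenProj - oddProj : Module.End ℂ (Schr F n)) = 1 := by
    rw [detEven, sub_mul, evenProj_mul_evenProj, oddProj_mul_evenProj, sub_zero,
      evenProj_add_oddProj, map_one]
  have hO : detOdd (evenProj - oddProj : Module.End ℂ (Schr F n)) = delta F ^ n := by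
    rw [detOdd, sub_mul, oddProj_mul_oddProj, evenProj_mul_oddProj, zero_sub]
    have := det_smul_add (oddProj : Module.End ℂ (Schr F n)) evenProj isIdempotentElem_oddProj
      (by rw [oddProj_eq]; abel) (-1)
    have h : (-oddProj : Module.End ℂ (Schr F n)) = (-1 : ℂ) • oddProj := by
      refine LinearMap.ext fun f => funext fun t => ?_
      simp
    rw [h, this]
    exact_mod_cast congrArg (Int.cast : ℤ → ℂ) (delta_pow (F := F) (n := n) hF)
  rw [← eq_weilOperator hF _ _ E_mul_parity (IsUnit.of_mul_eq_one _ hP2).ne_zero, hE, hO, div_one]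

/-! ### The element J and the Fourier transform -/

/-- The symplectic matrix `J`. -/
def jElem (F : Type*) [Field F] (n : ℕ) : Sp F n :=
  ⟨Matrix.J (Fin n) F, SymplecticGroup.J_mem _ _⟩

/-- The Fourier transform on the functions on `F ^ n`. -/
def fourierOp : Module.End ℂ (Schr F n) where
  toFun f t := ∑ s, canonicalChar F (-(2 * (s ⬝ᵥ t))) * f s
  map_add' f g := by ext t; simp [mul_add, Finset.sum_add_distrib]
  map_smul' c f := by ext t; simp [mul_left_comm, Finset.mul_sum]

lemma fourierOp_apply (f : Schr F n) (t : Fin n → F) :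
    fourierOp f t = ∑ s, canonicalChar F (-(2 * (s ⬝ᵥ t))) * f s := rfl

lemma E_mul_fourierOp (v : Vec F n) :
    E v * fourierOp = fourierOp * E (v ᵥ* (jElem F n).1) := by
  ext1 f
  funext t
  have h1 : (v ᵥ* (jElem F n).1) ∘ Sum.inl = v ∘ Sum.inr := by
    simp [jElem, Matrix.J, Matrix.vecMul_fromBlocks]
  have h2 : (v ᵥ* (jElem F n).1) ∘ Sum.inr = -(v ∘ Sum.inl) := by
    simp [jElem, Matrix.J, Matrix.vecMul_fromBlocks, Matrix.vecMul_neg]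
  simp only [Module.End.mul_apply, E_apply, fourierOp_apply, h1, h2]
  rw [Finset.mul_sum, ← Equiv.sum_comp (Equiv.addRight (v ∘ Sum.inl))]
  refine Finset.sum_congr rfl fun s _ => ?_
  rw [Equiv.coe_addRight, sub_neg_eq_add, ← mul_assoc, ← mul_assoc, ← AddChar.map_add_eq_mul,
    ← AddChar.map_add_eq_mul]
  congr 2
  simp only [dotProduct_sub, add_dotProduct, dotProduct_neg]
  rw [dotProduct_comm s (v ∘ Sum.inr), dotProduct_comm (v ∘ Sum.inr) (v ∘ Sum.inl)]
  ring

/-- The scalar, a Gauss sum up to normalization, need not be computed: only the invariance of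
subspaces under the Fourier transform is used. -/
lemma exists_smul_weilOperator_jElem (hF : ringChar F ≠ 2) :
    ∃ c : ℂ, fourierOp = c • weilOperator (jElem F n) := by
  classical
  have hA0 : (fourierOp : Module.End ℂ (Schr F n)) ≠ 0 := by
    intro h
    have := congrFun (LinearMap.congr_fun h (Pi.single 0 1)) (0 : Fin n → F)
    simp [fourierOp_apply] at this
  have h := eq_weilOperator hF (jElem F n) fourierOp E_mul_fourierOp hA0
  have hc : detOdd (fourierOp : Module.End ℂ (Schr F n)) / detEven (F := F) (n := n) fourierOp ≠ 0 := by
    intro h0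
    rw [h0, zero_smul] at h
    have h1 := weilOperator_mul hF (jElem F n) (jElem F n)⁻¹
    rw [← h, mul_inv_cancel, weilOperator_one hF, zero_mul] at h1
    exact one_ne_zero h1
  exact ⟨_, ((inv_smul_eq_iff₀ hc).2 h.symm).symm⟩

end

/-! ### Irreducibility of the even and the odd functions -/

section

variable {F : Type*} [Field F] [Fintype F] {n : ℕ}

/-- The vectors `s` and `t` have the same image `s sᵀ = t tᵀ` only if `s = ± t`. -/
lemma eq_or_eq_neg_of_mul_eq {s t : Fin n → F} (h : ∀ i j, s i * s j = t i * t j) :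
    s = t ∨ s = -t := by
  by_cases ht : t = 0
  · left
    rw [ht]
    funext i
    have := h i i
    rw [ht] at this
    simpa using this
  · obtain ⟨i, hi⟩ := Function.ne_iff.1 ht
    simp only [Pi.zero_apply] at hi
    rcases mul_self_eq_mul_self_iff.1 (h i i) with h1 | h1
    · left
      funext j
      have := h i j
      rw [h1] at this
      exact mul_left_cancel₀ hi this
    · right
      funext j
      have := h i j
      rw [h1] at this
      refine mul_left_cancel₀ (neg_ne_zero.2 hi) ?_
      rw [this, Pi.neg_apply]
      ring

open Classical in
/-- Orthogonality of the characters `M ↦ ψ(t M tᵀ)` on square matrices. -/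
lemma sum_canonicalChar_sub (hF : ringChar F ≠ 2) (s t : Fin n → F) :
    ∑ M : Matrix (Fin n) (Fin n) F,
      canonicalChar F (2 * (t ⬝ᵥ M *ᵥ t) - 2 * (s ⬝ᵥ M *ᵥ s)) =
      if s = t ∨ s = -t then (Fintype.card (Matrix (Fin n) (Fin n) F) : ℂ) else 0 := by
  split_ifs with h
  · rw [Finset.sum_congr rfl (g := fun _ => (1 : ℂ)), Finset.sum_const, nsmul_one]
    · rfl
    · intro M _
      rcases h with rfl | rfl <;> simp [Matrix.mulVec_neg]
  -- The summand is an additive character of the matrix M. Testing it on the matrix units b·e_ij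
  -- shows that it is trivial only if s_i s_j = t_i t_j for all i, j.
  · let φ : Matrix (Fin n) (Fin n) F →+ F :=
      { toFun := fun M => 2 * (t ⬝ᵥ M *ᵥ t) - 2 * (s ⬝ᵥ M *ᵥ s)
        map_zero' := by simp
        map_add' := fun M N => by simp only [Matrix.add_mulVec, dotProduct_add]; ring }
    refine AddChar.sum_eq_zero_of_ne_one (ψ := (canonicalChar F).compAddMonoidHom φ) ?_
    intro h1
    apply h
    apply eq_or_eq_neg_of_mul_eq
    intro i j
    by_contra hij
    obtain ⟨b, hb⟩ := exists_canonicalChar_ne_one F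
      (mul_ne_zero (two_ne_zero' hF) (sub_ne_zero.2 (Ne.symm hij)))
    apply hb
    have h2 := DFunLike.congr_fun h1 (Matrix.single i j b)
    rw [AddChar.one_apply, AddChar.compAddMonoidHom_apply] at h2
    rw [← h2]
    congr 1
    simp only [φ, AddMonoidHom.coe_mk, ZeroHom.coe_mk, Matrix.single_mulVec]
    have h3 : ∀ (u : Fin n → F) (c : F), u ⬝ᵥ Function.update 0 i c = u i * c :=
      fun u c => dotProduct_single u c i
    rw [h3, h3]
    ring

/-- Restriction of a function to `{t, -t}` preserves every subspace invariant under the Weil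
operators of the matrices `g_Q`. -/
lemma restrict_mem (hF : ringChar F ≠ 2) {U : Submodule ℂ (Schr F n)}
    (hU : ∀ g : Sp F n, ∀ f ∈ U, weilOperator g f ∈ U) {f : Schr F n} (hf : f ∈ U)
    (t : Fin n → F) [∀ s, Decidable (s = t ∨ s = -t)] :
    (fun s => if s = t ∨ s = -t then f s else 0) ∈ U := by
  classical
  have hs : ∀ M : Matrix (Fin n) (Fin n) F, (M + Mᵀ).IsSymm := fun M =>
    Matrix.isSymm_add_transpose_self M
  -- The summand multiplies f(s) by ψ(2tMtᵀ - 2sMsᵀ), so summing over M isolates s = ±t. Writing the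
  -- symmetric matrix as M + Mᵀ lets M range over all matrices, where matrix units are available.
  have h : (∑ M : Matrix (Fin n) (Fin n) F, canonicalChar F (2 * (t ⬝ᵥ M *ᵥ t)) •
      weilOperator (lower (M + Mᵀ) (hs M)) f) ∈ U :=
    U.sum_mem fun M _ => U.smul_mem _ (hU _ _ hf)
  have hc : (Fintype.card (Matrix (Fin n) (Fin n) F) : ℂ) ≠ 0 :=
    Nat.cast_ne_zero.2 Fintype.card_ne_zero
  convert U.smul_mem (Fintype.card (Matrix (Fin n) (Fin n) F) : ℂ)⁻¹ h using 1
  funext s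
  rw [Pi.smul_apply, Finset.sum_apply, smul_eq_mul, eq_inv_mul_iff_mul_eq₀ hc]
  trans (∑ M : Matrix (Fin n) (Fin n) F,
      canonicalChar F (2 * (t ⬝ᵥ M *ᵥ t) - 2 * (s ⬝ᵥ M *ᵥ s))) * f s
  · rw [sum_canonicalChar_sub hF]
    split_ifs <;> simp
  · rw [Finset.sum_mul]
    refine Finset.sum_congr rfl fun M _ => ?_
    rw [weilOperator_lower hF, Pi.smul_apply, mulOp_apply, smul_eq_mul, ← mul_assoc,
      ← AddChar.map_add_eq_mul]
    congr 2
    rw [Matrix.add_mulVec, dotProduct_add, Matrix.mulVec_transpose,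
      dotProduct_comm s (s ᵥ* M), ← Matrix.dotProduct_mulVec]
    ring

open Classical in
lemma parityProj_single_apply (ε : ℤ) (t s : Fin n → F) :
    parityProj ε (Pi.single t 1 : Schr F n) s =
      ((if s = t then 1 else 0) + ε * (if s = -t then 1 else 0)) / 2 := by
  rw [parityProj_apply, Pi.single_apply, Pi.single_apply]
  simp only [neg_eq_iff_eq_neg]

-- The restriction of f to {t, -t} is determined by f(t) and the parity, hence is a nonzero multiple
-- of the symmetrized delta function at t.
open Classical in
lemma parityProj_single_mem (hF : ringChar F ≠ 2) {ε : ℤ} (hε : ε = 1 ∨ ε = -1)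
    {U : Submodule ℂ (Schr F n)}
    (hU : ∀ g : Sp F n, ∀ f ∈ U, weilOperator g f ∈ U) {f : Schr F n} (hf : f ∈ U)
    (hpf : parityProj ε f = f) {t : Fin n → F} (ht : f t ≠ 0) :
    parityProj ε (Pi.single t 1 : Schr F n) ∈ U := by
  have h := restrict_mem hF hU hf t
  have hp : f t = ε * f (-t) := by
    have := congrFun hpf t
    rw [parityProj_apply] at this
    linear_combination -2 * this
  have hε2 : (ε : ℂ) * ε = 1 := by rcases hε with rfl | rfl <;> simp
  have hp' : f (-t) = ε * f t := by rw [hp, ← mul_assoc, hε2, one_mul]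
  -- The symmetrized delta function has value 1/2 at t when t ≠ -t. At t = 0 the value is 1, because
  -- f(0) = εf(0) ≠ 0 forces ε = 1.
  convert U.smul_mem ((if t = 0 then 1 else 2⁻¹) / f t) h using 1
  funext s
  rw [parityProj_single_apply, Pi.smul_apply, smul_eq_mul]
  by_cases h0 : t = 0
  · subst h0
    by_cases hs : s = 0
    · subst hs
      rw [neg_zero] at hp'
      have : (ε : ℂ) = 1 := mul_right_cancel₀ ht (by rw [← hp', one_mul])
      simp [this, ht]
    · simp [hs]
  · have hn : ¬ t = -t := fun h => h0 ((neg_eq_self_iff' hF t).1 h.symm)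
    by_cases hs : s = t
    · subst hs
      simp [hn, h0, ht]
    · by_cases hs' : s = -t
      · subst hs'
        simp only [hs, h0, hp', if_true, if_false, or_true, zero_add, mul_one]
        field_simp
      · simp [hs, hs']

-- The left side of `hst` is twice the value at s of the Fourier transform of the symmetrized delta
-- function at t; where it is nonzero, `parityProj_single_mem` applies at s.
open Classical in
lemma parityProj_single_mem_of_ne (hF : ringChar F ≠ 2) {ε : ℤ} (hε : ε = 1 ∨ ε = -1)
    {U : Submodule ℂ (Schr F n)}
    (hU : ∀ g : Sp F n, ∀ f ∈ U, weilOperator g f ∈ U) (hpU : ∀ f ∈ U, parityProj ε f = f)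
    {s t : Fin n → F} (ht : parityProj ε (Pi.single t 1 : Schr F n) ∈ U)
    (hst : canonicalChar F (-(2 * (t ⬝ᵥ s))) + ε * canonicalChar F (2 * (t ⬝ᵥ s)) ≠ 0) :
    parityProj ε (Pi.single s 1 : Schr F n) ∈ U := by
  obtain ⟨c, hc⟩ := exists_smul_weilOperator_jElem (F := F) (n := n) hF
  have hm : fourierOp (parityProj ε (Pi.single t 1 : Schr F n)) ∈ U := by
    rw [hc]
    exact U.smul_mem _ (hU _ _ ht)
  refine parityProj_single_mem hF hε hU hm (hpU _ hm) ?_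
  rw [fourierOp_apply]
  simp only [parityProj_single_apply, mul_div_assoc', mul_add]
  rw [← Finset.sum_div, Finset.sum_add_distrib]
  simp only [mul_ite, mul_one, mul_zero, Finset.sum_ite_eq', Finset.mem_univ, if_true,
    neg_dotProduct, mul_neg, neg_neg]
  rw [mul_comm _ (ε : ℂ)]
  exact div_ne_zero hst two_ne_zero

/-- The x violating either condition form a proper subgroup, and a group is not the union of two
proper subgroups. -/
lemma exists_char_ne_one_both (hF : ringChar F ≠ 2) {a b : Fin n → F} (ha : a ≠ 0) (hb : b ≠ 0) :
    ∃ x : Fin n → F, canonicalChar F (2 * (x ⬝ᵥ a)) ≠ 1 ∧ canonicalChar F (2 * (x ⬝ᵥ b)) ≠ 1 := by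
  obtain ⟨x, hx⟩ := exists_char_ne_one hF ha
  obtain ⟨y, hy⟩ := exists_char_ne_one hF hb
  by_cases h1 : canonicalChar F (2 * (x ⬝ᵥ b)) = 1
  · by_cases h2 : canonicalChar F (2 * (y ⬝ᵥ a)) = 1
    · refine ⟨x + y, ?_, ?_⟩
      · rwa [add_dotProduct, mul_add, AddChar.map_add_eq_mul, h2, mul_one]
      · rwa [add_dotProduct, mul_add, AddChar.map_add_eq_mul, h1, one_mul]
    · exact ⟨y, h2, hy⟩
  · exact ⟨x, hx, h1⟩

lemma canonicalChar_sub_ne_zero {a : F} (ha : canonicalChar F (2 * a) ≠ 1) :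
    canonicalChar F (-a) - canonicalChar F a ≠ 0 := by
  intro h
  apply ha
  rw [two_mul, AddChar.map_add_eq_mul]
  nth_rw 1 [← sub_eq_zero.1 h]
  rw [← AddChar.map_add_eq_mul, neg_add_cancel, AddChar.map_zero_eq_one]

-- Any two points are joined by two Fourier steps: through 0 for even functions, and through a
-- suitable third point s for odd ones.
open Classical in
lemma parityProj_single_mem_all (hF : ringChar F ≠ 2) {ε : ℤ} (hε : ε = 1 ∨ ε = -1)
    {U : Submodule ℂ (Schr F n)}
    (hU : ∀ g : Sp F n, ∀ f ∈ U, weilOperator g f ∈ U) (hpU : ∀ f ∈ U, parityProj ε f = f)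
    {f : Schr F n} (hf : f ∈ U) (hf0 : f ≠ 0) (t : Fin n → F) :
    parityProj ε (Pi.single t 1 : Schr F n) ∈ U := by
  obtain ⟨r, hr⟩ := Function.ne_iff.1 hf0
  have hrU := parityProj_single_mem hF hε hU hf (hpU f hf) hr
  rcases hε with rfl | rfl
  · have h0 : parityProj 1 (Pi.single 0 1 : Schr F n) ∈ U :=
      parityProj_single_mem_of_ne hF (Or.inl rfl) hU hpU hrU (by simp)
    exact parityProj_single_mem_of_ne hF (Or.inl rfl) hU hpU h0 (by simp)
  -- For odd parity the antisymmetrized delta function at 0 is zero.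
  · by_cases ht : t = 0
    · convert U.zero_mem
      funext s
      rw [parityProj_single_apply, ht]
      simp only [neg_zero]
      split_ifs <;> simp
    · have hr0 : r ≠ 0 := by
        rintro rfl
        apply hr
        have := congrFun (hpU f hf) 0
        rw [parityProj_apply] at this
        simpa using this.symm
      have h2 := two_ne_zero' (F := F) hF
      -- The vectors are doubled because ψ(-a) ≠ ψ(a) amounts to ψ(2a) ≠ 1, here with a = 2rsᵀ and a
      -- = 2tsᵀ.
      obtain ⟨s, hs1, hs2⟩ := exists_char_ne_one_both hF (smul_ne_zero h2 hr0)
        (smul_ne_zero h2 ht)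
      rw [dotProduct_smul, smul_eq_mul] at hs1 hs2
      have hsU : parityProj (-1) (Pi.single s 1 : Schr F n) ∈ U := by
        refine parityProj_single_mem_of_ne hF (Or.inr rfl) hU hpU hrU ?_
        have := canonicalChar_sub_ne_zero hs1
        rw [dotProduct_comm]
        simpa [sub_eq_add_neg] using this
      refine parityProj_single_mem_of_ne hF (Or.inr rfl) hU hpU hsU ?_
      have := canonicalChar_sub_ne_zero hs2
      simpa [sub_eq_add_neg] using this

/-- The even functions, as well as the odd functions, have no proper nonzero subspace that is
invariant under the Weil operators. -/
lemma mem_of_parityProj_eq (hF : ringChar F ≠ 2) {ε : ℤ} (hε : ε = 1 ∨ ε = -1)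
    {U : Submodule ℂ (Schr F n)}
    (hU : ∀ g : Sp F n, ∀ f ∈ U, weilOperator g f ∈ U) (hpU : ∀ f ∈ U, parityProj ε f = f)
    {f : Schr F n} (hf : f ∈ U) (hf0 : f ≠ 0) {h : Schr F n} (hh : parityProj ε h = h) :
    h ∈ U := by
  classical
  have key : (∑ t, h t • (Pi.single t 1 : Schr F n)) = h := by
    funext s
    simp [Finset.sum_apply, Pi.single_apply]
  rw [← hh, ← key, map_sum]
  refine U.sum_mem fun t _ => ?_
  rw [map_smul]
  exact U.smul_mem _ (parityProj_single_mem_all hF hε hU hpU hf hf0 t)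

end

/-! ### Irreducible characters -/

/-- If the range of an idempotent `p` commuting with a representation `ρ` has no proper nonzero
invariant subspace, then `g ↦ tr (ρ g p)` is an irreducible character. -/
lemma isIrreducibleCharacter_trace_mul {H V : Type*} [Group H] [AddCommGroup V] [Module ℂ V]
    [FiniteDimensional ℂ V] (ρ : Representation ℂ H V) (p : Module.End ℂ V)
    (hp : IsIdempotentElem p) (hc : ∀ g, p * ρ g = ρ g * p) (hp0 : p ≠ 0)
    (h : ∀ U : Submodule ℂ V, (∀ g, ∀ v ∈ U, ρ g v ∈ U) → U ≤ LinearMap.range p → U ≠ ⊥ →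
      LinearMap.range p ≤ U) :
    IsIrreducibleCharacter (fun g => LinearMap.trace ℂ V (ρ g * p)) := by
  -- `IsIrreducibleCharacter` asks for a representation on some ℂ^d, so the range of p is put in
  -- coordinates, with ι π = p and π ι = 1.
  let e := (Module.finBasis ℂ (LinearMap.range p)).equivFun
  let ι : (Fin (Module.finrank ℂ (LinearMap.range p)) → ℂ) →ₗ[ℂ] V :=
    (LinearMap.range p).subtype ∘ₗ e.symm.toLinearMap
  let π : V →ₗ[ℂ] (Fin (Module.finrank ℂ (LinearMap.range p)) → ℂ) :=
    e.toLinearMap ∘ₗ p.rangeRestrict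
  have hιπ : ∀ v, ι (π v) = p v := fun v => by simp [ι, π]
  have hpι : ∀ x, p (ι x) = ι x := fun x => by
    obtain ⟨v, hv⟩ := (e.symm x).2
    change p ((e.symm x : LinearMap.range p) : V) = _
    rw [← hv]
    change (p * p) v = _
    rw [hp]
    exact hv
  have hι : Function.Injective ι :=
    (LinearMap.range p).injective_subtype.comp e.symm.injective
  have hπι : ∀ x, π (ι x) = x := fun x => hι (by rw [hιπ, hpι])
  have hρι : ∀ g x, ι (π (ρ g (ι x))) = ρ g (ι x) := fun g x => by
    rw [hιπ, ← Module.End.mul_apply, hc, Module.End.mul_apply, hpι]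
  let σ : Representation ℂ H (Fin (Module.finrank ℂ (LinearMap.range p)) → ℂ) :=
    { toFun := fun g => π ∘ₗ ρ g ∘ₗ ι
      map_one' := LinearMap.ext fun x => by simp [hπι]
      map_mul' := fun g g' => LinearMap.ext fun x => by
        simp [hρι] }
  have hσ : ∀ g x, ι (σ g x) = ρ g (ι x) := hρι
  have hnt : Nontrivial (LinearMap.range p) := by
    rw [Submodule.nontrivial_iff_ne_bot]
    exact fun h0 => hp0 (LinearMap.range_eq_bot.1 h0)
  have hnt2 := e.symm.toEquiv.nontrivial
  refine ⟨_, σ, ?_, ?_⟩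
  · have hbt : (⊥ : Subrepresentation σ) ≠ ⊤ := fun h0 =>
      bot_ne_top (α := Submodule ℂ (Fin (Module.finrank ℂ (LinearMap.range p)) → ℂ))
        (congrArg Subrepresentation.toSubmodule h0)
    refine { exists_pair_ne := ⟨⊥, ⊤, hbt⟩, eq_bot_or_eq_top := fun W => ?_ }
    by_cases hW : W.toSubmodule = ⊥
    · left
      exact Subrepresentation.toSubmodule_injective hW
    · right
      apply Subrepresentation.toSubmodule_injective
      have h1 := h (W.toSubmodule.map ι) (by
        rintro g _ ⟨x, hx, rfl⟩
        exact ⟨σ g x, W.apply_mem_toSubmodule g hx, hσ g x⟩) (by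
        rintro _ ⟨x, hx, rfl⟩
        exact ⟨ι x, hpι x⟩) (by
        intro h0
        refine hW (eq_bot_iff.2 fun x hx => ?_)
        have h2 : ι x ∈ W.toSubmodule.map ι := ⟨x, hx, rfl⟩
        rw [h0] at h2
        exact hι (by rw [map_zero]; exact h2))
      refine (Submodule.eq_top_iff'.2 fun x => ?_ : W.toSubmodule = ⊤)
      obtain ⟨w, hw, hwx⟩ := h1 ⟨ι x, hpι x⟩
      rwa [← hι hwx]
  · funext g
    have h1 : ρ g * p = (ρ g ∘ₗ ι) ∘ₗ π := LinearMap.ext fun v => by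
      simp [hιπ]
    rw [h1, LinearMap.trace_comp_comm']
    rfl

lemma isIrreducibleCharacter_monoidHom {H : Type*} [Group H] (l : H →* ℂ) :
    IsIrreducibleCharacter l := by
  have h := isIrreducibleCharacter_trace_mul (H := H) (V := ℂ)
    ((algebraMap ℂ (Module.End ℂ ℂ)).toMonoidHom.comp l) 1 IsIdempotentElem.one
    (fun g => by rw [one_mul, mul_one]) one_ne_zero (fun U _ _ hU => by
      rw [(eq_bot_or_eq_top U).resolve_left hU]
      exact le_top)
  convert h using 1
  funext g
  change l g = LinearMap.trace ℂ ℂ (algebraMap ℂ (Module.End ℂ ℂ) (l g) * 1)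
  rw [mul_one, Algebra.algebraMap_eq_smul_one, map_smul, LinearMap.trace_one]
  simp

open Classical in
/-- Orthogonality of irreducible characters. -/
lemma IsIrreducibleCharacter.inner_eq {H : Type*} [Group H] [Fintype H] {χ θ : H → ℂ}
    (hχ : IsIrreducibleCharacter χ) (hθ : IsIrreducibleCharacter θ) :
    (Nat.card H : ℂ)⁻¹ * ∑ h : H, χ h * θ h⁻¹ = if χ = θ then 1 else 0 := by
  obtain ⟨c, ρ, hρ, rfl⟩ := hχ
  obtain ⟨d, σ, hσ, rfl⟩ := hθ
  have : Invertible (Nat.card H : ℂ) :=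
    invertibleOfNonzero (Nat.cast_ne_zero.2 Nat.card_pos.ne')
  have h := Representation.char_orthonormal ρ σ
  split_ifs with heq
  · rw [← heq, Representation.char_orthonormal ρ ρ, if_pos ⟨Representation.Equiv.refl ρ⟩]
  · rw [h, if_neg]
    rintro ⟨φ⟩
    exact heq (Representation.char_iso φ).symm

/-- A sum of two irreducible characters of different degrees determines them. -/
lemma IsIrreducibleCharacter.eq_of_add_eq {H : Type*} [Group H] [Finite H] {a b c d : H → ℂ}
    (ha : IsIrreducibleCharacter a) (hb : IsIrreducibleCharacter b)
    (hc : IsIrreducibleCharacter c) (hd : IsIrreducibleCharacter d)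
    (h : a + b = c + d) (hdc : d 1 ≠ c 1) (hbc : b 1 ≠ c 1) : a = c ∧ b = d := by
  classical
  have := Fintype.ofFinite H
  -- Both decompositions are paired with c. The degrees exclude b = c and d = c, so the multiplicity
  -- 1 of c must come from a.
  have h1 : (if a = c then (1 : ℂ) else 0) + (if b = c then 1 else 0) =
      (if c = c then 1 else 0) + (if d = c then 1 else 0) := by
    rw [← ha.inner_eq hc, ← hb.inner_eq hc, ← hc.inner_eq hc, ← hd.inner_eq hc, ← mul_add,
      ← mul_add, ← Finset.sum_add_distrib, ← Finset.sum_add_distrib]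
    congr 1
    refine Finset.sum_congr rfl fun x _ => ?_
    rw [← add_mul, ← add_mul]
    exact congrArg (· * c x⁻¹) (congrFun h x)
  rw [if_neg (fun h0 : b = c => hbc (congrFun h0 1)), if_pos rfl,
    if_neg (fun h0 : d = c => hdc (congrFun h0 1)), add_zero, add_zero] at h1
  have hac : a = c := by
    by_contra h0
    rw [if_neg h0] at h1
    exact zero_ne_one h1
  rw [hac] at h
  exact ⟨hac, add_left_cancel h⟩

/-- A sum of distinct linear characters is multiplicity free. -/
lemma multiplicityFree_sum {H ι : Type*} [Group H] [Finite H] (s : Finset ι) (l : ι → H →* ℂ)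
    (hl : Set.InjOn l s) (hconj : ∀ i h, starRingEnd ℂ (l i h) = l i h⁻¹) :
    MultiplicityFree (fun h => ∑ i ∈ s, l i h) := by
  classical
  intro θ hθ
  let _ := Fintype.ofFinite H
  -- The orthogonality relation involves θ(h) l(h⁻¹), while `charInner` conjugates θ. Conjugating
  -- the whole product moves the conjugation to the linear characters, where it is inversion.
  have h1 : starRingEnd ℂ (charInner (fun h => ∑ i ∈ s, l i h) θ) =
      ∑ i ∈ s, if θ = l i then 1 else 0 := by
    rw [charInner, map_mul, map_inv₀, map_natCast, map_sum]
    simp only [map_mul, map_sum, Complex.conj_conj, hconj]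
    rw [← Finset.sum_congr rfl fun i _ => hθ.inner_eq (isIrreducibleCharacter_monoidHom (l i)),
      ← Finset.mul_sum, Finset.sum_comm]
    congr 1
    refine Finset.sum_congr rfl fun h _ => ?_
    rw [Finset.sum_mul]
    exact Finset.sum_congr rfl fun i _ => mul_comm _ _
  have h2 : charInner (fun h => ∑ i ∈ s, l i h) θ = ∑ i ∈ s, if θ = l i then 1 else 0 := by
    rw [← Complex.conj_conj (charInner _ θ), h1, map_sum]
    refine Finset.sum_congr rfl fun i _ => ?_
    split_ifs <;> simp
  rw [h2]
  by_cases h : ∃ i ∈ s, θ = l i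
  · right
    obtain ⟨i, hi, hθi⟩ := h
    rw [Finset.sum_eq_single_of_mem i hi, if_pos hθi]
    intro j hj hji
    rw [if_neg]
    intro hθj
    exact hji (hl hj hi (DFunLike.coe_injective (hθj.symm.trans hθi)))
  · left
    exact Finset.sum_eq_zero fun i hi => if_neg fun h0 => h ⟨i, hi, h0⟩

/-! ### The even and the odd character on `G` and `B` -/

section

variable {F : Type*} [Field F] [Fintype F] {n : ℕ}

/-! ### Symmetric matrices of rank 1 and traces -/

lemma mul_vecMulVec_mul_transpose (P : Matrix (Fin n) (Fin n) F) (t : Fin n → F) :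
    P * Matrix.vecMulVec t t * Pᵀ = Matrix.vecMulVec (P *ᵥ t) (P *ᵥ t) := by
  rw [Matrix.mul_vecMulVec, Matrix.vecMulVec_mul, Matrix.vecMul_transpose]

lemma isSymm_neg_vecMulVec (t : Fin n → F) : (-Matrix.vecMulVec t t).IsSymm := by
  ext i j
  simp [Matrix.vecMulVec_apply, mul_comm]

lemma rank_of_diagonalizes {P Q : Matrix (Fin n) (Fin n) F} {d : Fin n → F}
    (h : Diagonalizes P d Q) : (Matrix.diagonal d).rank = Q.rank := by
  rw [← h.2, Matrix.rank_mul_eq_left_of_isUnit_det _ _ (by rw [Matrix.det_transpose]; exact h.1),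
    Matrix.rank_mul_eq_right_of_isUnit_det _ _ h.1]

/-- A diagonal matrix congruent to `-t tᵀ` has exactly one nonzero entry, the negative of a
square. -/
lemma exists_of_diagonalizes_neg_vecMulVec {P : Matrix (Fin n) (Fin n) F} {d t : Fin n → F}
    (ht : t ≠ 0) (h : Diagonalizes P d (-Matrix.vecMulVec t t)) :
    ∃ i, ∃ c : F, c ≠ 0 ∧ d = Pi.single i (-(c * c)) := by
  obtain ⟨hP, h⟩ := h
  rw [Matrix.mul_neg, Matrix.neg_mul, mul_vecMulVec_mul_transpose] at h
  have hu : P *ᵥ t ≠ 0 := fun h0 => ht (Matrix.eq_zero_of_mulVec_eq_zero hP.ne_zero h0)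
  obtain ⟨i, hi⟩ := Function.ne_iff.1 hu
  rw [Pi.zero_apply] at hi
  refine ⟨i, (P *ᵥ t) i, hi, ?_⟩
  funext j
  have hj := congrFun (congrFun h j) j
  rw [Matrix.diagonal_apply_eq, Matrix.neg_apply, Matrix.vecMulVec_apply] at hj
  by_cases hij : j = i
  · subst hij
    rw [← hj, Pi.single_eq_same]
  · have h2 := congrFun (congrFun h i) j
    rw [Matrix.diagonal_apply_ne _ (Ne.symm hij), Matrix.neg_apply, Matrix.vecMulVec_apply,
      neg_eq_zero] at h2
    rw [Pi.single_eq_of_ne hij, ← hj, (mul_eq_zero.1 h2).resolve_left hi]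
    simp

lemma prod_filter_single [DecidableEq F] (i : Fin n) {a : F} (ha : a ≠ 0) :
    ∏ j with (Pi.single i a : Fin n → F) j ≠ 0, (Pi.single i a : Fin n → F) j = a := by
  have h : Finset.univ.filter (fun j => (Pi.single i a : Fin n → F) j ≠ 0) = {i} := by
    ext j
    simp only [Finset.mem_filter, Finset.mem_univ, true_and, Finset.mem_singleton]
    by_cases hij : j = i
    · subst hij; simp [ha]
    · simp [hij]
  rw [h, Finset.prod_singleton, Pi.single_eq_same]

lemma quadraticChar_neg_mul_self [DecidableEq F] {c : F} (hc : c ≠ 0) :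
    quadraticChar F (-(c * c)) = quadraticChar F (-1) := by
  rw [← neg_one_mul, map_mul, ← sq c, quadraticChar_sq_one' hc, mul_one]

/-- The symmetric matrices `S` of rank `1` with `Δ(S) = δ` are the matrices `-t tᵀ`. -/
lemma mem_rankOneSet_iff (hF : ringChar F ≠ 2) (S : Matrix (Fin n) (Fin n) F) :
    S ∈ rankOneSet F n ↔ ∃ t : Fin n → F, t ≠ 0 ∧ S = -Matrix.vecMulVec t t := by
  classical
  rw [rankOneSet, Finset.mem_filter]
  simp only [Finset.mem_univ, true_and]
  constructor
  · rintro ⟨hS, hr, hD⟩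
    have hex := exists_diagonalizes hF hS
    rw [Delta, dif_pos hex, delta] at hD
    have hPd := hex.choose_spec
    set P := hex.choose.1
    set d := hex.choose.2
    have hr1 := rank_of_diagonalizes hPd
    rw [hr, Matrix.rank_diagonal] at hr1
    obtain ⟨⟨i, hi⟩, hi'⟩ := Fintype.card_eq_one_iff.1 hr1
    have hd : d = Pi.single i (d i) := by
      funext j
      by_cases hij : j = i
      · subst hij; simp
      · rw [Pi.single_eq_of_ne hij]
        by_contra hj
        exact hij (congrArg Subtype.val (hi' ⟨j, hj⟩))
    rw [hd, prod_filter_single i hi] at hD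
    -- The single nonzero entry d_i satisfies χ(d_i) = χ(-1), so -d_i is a square c². The vector
    -- sought is then P⁻¹ applied to c·e_i.
    have hsq : quadraticChar F (-d i) = 1 := by
      rw [← neg_one_mul, map_mul, hD, ← map_mul]
      simp
    obtain ⟨c, hc⟩ := (quadraticChar_one_iff_isSquare (neg_ne_zero.2 hi)).1 hsq
    have hdi : d i = -(c * c) := by rw [← hc, neg_neg]
    have hdet : IsUnit P.det := hPd.1
    have hdiag : Matrix.diagonal d = -Matrix.vecMulVec (Pi.single i c) (Pi.single i c) := by
      rw [hd, hdi]
      ext j k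
      rw [Matrix.neg_apply, Matrix.vecMulVec_apply, Matrix.diagonal_apply]
      by_cases hj : j = i
      · subst hj
        by_cases hk : k = j
        · subst hk; simp
        · simp [hk, Ne.symm hk]
      · simp [hj]
    refine ⟨P⁻¹ *ᵥ Pi.single i c, ?_, ?_⟩
    · intro h0
      have h1 : P *ᵥ (P⁻¹ *ᵥ Pi.single i c) = 0 := by rw [h0, Matrix.mulVec_zero]
      rw [Matrix.mulVec_mulVec, Matrix.mul_nonsing_inv _ hdet, Matrix.one_mulVec,
        Pi.single_eq_zero_iff] at h1
      rw [h1] at hdi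
      exact hi (by rw [hdi]; simp)
    · rw [← mul_vecMulVec_mul_transpose, ← Matrix.neg_mul, ← Matrix.mul_neg, ← hdiag, ← hPd.2]
      change S = P⁻¹ * (P * S * Pᵀ) * P⁻¹ᵀ
      rw [Matrix.transpose_nonsing_inv, ← Matrix.mul_assoc, ← Matrix.mul_assoc,
        Matrix.nonsing_inv_mul _ hdet, Matrix.one_mul, Matrix.mul_assoc, Matrix.mul_nonsing_inv,
        Matrix.mul_one]
      rwa [Matrix.det_transpose]
  · rintro ⟨t, ht, rfl⟩
    -- `Delta` uses an arbitrarily chosen diagonalization; every one of this matrix has a negative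
    -- square as its only nonzero entry, so the choice is harmless.
    have hex := exists_diagonalizes hF (isSymm_neg_vecMulVec t)
    obtain ⟨i, c, hc, hd⟩ := exists_of_diagonalizes_neg_vecMulVec ht hex.choose_spec
    have hc2 : -(c * c) ≠ 0 := neg_ne_zero.2 (mul_self_ne_zero.2 hc)
    refine ⟨isSymm_neg_vecMulVec t, ?_, ?_⟩
    · rw [← rank_of_diagonalizes hex.choose_spec, hd, Matrix.rank_diagonal,
        Fintype.card_eq_one_iff]
      refine ⟨⟨i, by simpa using hc⟩, fun ⟨j, hj⟩ => ?_⟩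
      apply Subtype.ext
      by_contra hij
      exact hj (Pi.single_eq_of_ne hij _)
    · rw [Delta, dif_pos hex, hd, prod_filter_single i hc2, delta, quadraticChar_neg_mul_self hc]

-- The map t ↦ -ttᵀ from nonzero vectors onto `rankOneSet` has fibres {t, -t} of size exactly 2.
open Classical in
lemma two_mul_sum_rankOneSet (hF : ringChar F ≠ 2) (f : Matrix (Fin n) (Fin n) F → ℂ) :
    2 * ∑ S ∈ rankOneSet F n, f S =
      ∑ t : Fin n → F with t ≠ 0, f (-Matrix.vecMulVec t t) := by
  rw [← Finset.sum_fiberwise_of_maps_to (s := Finset.univ.filter fun t : Fin n → F => t ≠ 0)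
    (t := rankOneSet F n) (g := fun t => -Matrix.vecMulVec t t), Finset.mul_sum]
  · refine Finset.sum_congr rfl fun S hS => ?_
    obtain ⟨t, ht, rfl⟩ := (mem_rankOneSet_iff hF S).1 hS
    have h : (Finset.univ.filter fun t : Fin n → F => t ≠ 0).filter
        (fun s => -Matrix.vecMulVec s s = -Matrix.vecMulVec t t) = {t, -t} := by
      ext s
      simp only [Finset.mem_filter, Finset.mem_univ, true_and, Finset.mem_insert,
        Finset.mem_singleton, neg_inj]
      constructor
      · rintro ⟨-, h⟩
        exact eq_or_eq_neg_of_mul_eq fun i j => congrFun (congrFun h i) j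
      · rintro (rfl | rfl)
        · exact ⟨ht, rfl⟩
        · refine ⟨neg_ne_zero.2 ht, ?_⟩
          ext i j
          simp [Matrix.vecMulVec_apply]
    rw [h, Finset.sum_pair (fun h0 => ht ((neg_eq_self_iff' hF t).1 h0.symm)), two_mul]
    congr 2
    ext i j
    simp [Matrix.vecMulVec_apply]
  · intro t ht
    exact (mem_rankOneSet_iff hF _).2 ⟨t, (Finset.mem_filter.1 ht).2, rfl⟩

-- In the basis of delta functions the diagonal entry at t is a(t)/2, with an extra εa(0)/2 at t =
-- 0, the only point with t = -t.
open Classical in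
lemma trace_mulOp_mul_parityProj (hF : ringChar F ≠ 2) (a : Schr F n) (ε : ℤ) :
    LinearMap.trace ℂ _ (mulOp a * parityProj ε) =
      (a 0 * (1 + ε) + ∑ t : Fin n → F with t ≠ 0, a t) / 2 := by
  rw [LinearMap.trace_eq_matrix_trace ℂ (Pi.basisFun ℂ (Fin n → F)), Matrix.trace,
    ← Finset.add_sum_erase _ _ (Finset.mem_univ 0), add_div, Finset.sum_div]
  have h : ∀ t : Fin n → F, (LinearMap.toMatrix (Pi.basisFun ℂ (Fin n → F))
      (Pi.basisFun ℂ (Fin n → F)) (mulOp a * parityProj ε)).diag t =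
      a t * ((1 + ε * (if t = 0 then 1 else 0)) / 2) := by
    intro t
    rw [Matrix.diag_apply, LinearMap.toMatrix_apply, Pi.basisFun_repr, Pi.basisFun_apply,
      Module.End.mul_apply, mulOp_apply, parityProj_single_apply, if_pos rfl]
    simp only [← neg_eq_self_iff' hF t, eq_comm (a := t) (b := -t)]
  congr 1
  · rw [h, if_pos rfl]; ring
  · rw [← Finset.filter_ne' Finset.univ]
    refine Finset.sum_congr rfl fun t ht => ?_
    rw [h, if_neg (Finset.mem_filter.1 ht).2]
    ring

/-! ### The even and the odd constituents of ω -/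

/-- The character of the Weil representation on the functions of parity `ε`. -/
def parityChar (F : Type*) [Field F] [Fintype F] (n : ℕ) (ε : ℤ) (g : Sp F n) : ℂ :=
  LinearMap.trace ℂ _ (weilOperator g * parityProj ε)

lemma parityChar_lower (hF : ringChar F ≠ 2) (ε : ℤ) {Q : Matrix (Fin n) (Fin n) F}
    (hQ : Q.IsSymm) : parityChar F n ε (lower Q hQ) =
      (1 + ε) / 2 + ∑ S ∈ rankOneSet F n, canonicalChar F (S * Q).trace := by
  classical
  have h := two_mul_sum_rankOneSet hF fun S => canonicalChar F (S * Q).trace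
  have h1 : ∀ t : Fin n → F, (-Matrix.vecMulVec t t * Q).trace = -(t ⬝ᵥ Q *ᵥ t) := by
    intro t
    rw [Matrix.neg_mul, Matrix.trace_neg, Matrix.vecMulVec_mul, Matrix.trace_vecMulVec,
      Matrix.dotProduct_mulVec, dotProduct_comm]
  simp only [h1] at h
  rw [parityChar, weilOperator_lower hF, trace_mulOp_mul_parityProj hF, ← h]
  simp
  ring

lemma parityProj_mul_self {ε : ℤ} (hε : ε = 1 ∨ ε = -1) :
    IsIdempotentElem (parityProj ε : Module.End ℂ (Schr F n)) := by
  rcases hε with rfl | rfl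
  · rw [parityProj_one]; exact isIdempotentElem_evenProj
  · rw [parityProj_neg_one]; exact isIdempotentElem_oddProj

lemma parityProj_comm {ε : ℤ} (hε : ε = 1 ∨ ε = -1) (g : Sp F n) :
    parityProj ε * weilOperator g = weilOperator g * parityProj ε := by
  have h : evenProj * weilOperator g = weilOperator g * evenProj := by
    rw [weilOperator, mul_smul_comm, smul_mul_assoc, evenProj_comm_intertwiner]
  rcases hε with rfl | rfl
  · rw [parityProj_one, h]
  · rw [parityProj_neg_one, oddProj_comm h]

/-- Here n ≥ 1 supplies a vector t ≠ -t; for n = 0 there are no nonzero odd functions. -/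
lemma parityProj_ne_zero (hF : ringChar F ≠ 2) (hn : 1 ≤ n) (ε : ℤ) :
    (parityProj ε : Module.End ℂ (Schr F n)) ≠ 0 := by
  classical
  intro h
  have ht : (fun _ => 1 : Fin n → F) ≠ 0 := fun h => one_ne_zero (congrFun h ⟨0, hn⟩)
  have h1 := congrFun (LinearMap.congr_fun h (Pi.single (fun _ => 1) 1)) (fun _ => 1 : Fin n → F)
  rw [parityProj_single_apply, if_pos rfl,
    if_neg fun h => ht ((neg_eq_self_iff' hF _).1 h.symm)] at h1
  simp at h1

lemma isIrreducibleCharacter_parityChar (hF : ringChar F ≠ 2) (hn : 1 ≤ n) {ε : ℤ}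
    (hε : ε = 1 ∨ ε = -1) : IsIrreducibleCharacter (parityChar F n ε) := by
  refine isIrreducibleCharacter_trace_mul (weilRep F n hF) (parityProj ε) (parityProj_mul_self hε)
    (parityProj_comm hε) (parityProj_ne_zero hF hn ε) fun U hU hUp hU0 => ?_
  have hp : ∀ f ∈ LinearMap.range (parityProj ε : Module.End ℂ (Schr F n)),
      parityProj ε f = f := by
    rintro _ ⟨f, rfl⟩
    exact LinearMap.congr_fun (parityProj_mul_self hε) f
  obtain ⟨f, hf, hf0⟩ := U.exists_mem_ne_zero_of_ne_bot hU0
  exact fun h hh => mem_of_parityProj_eq hF hε hU (fun f hf => hp f (hUp hf)) hf hf0 (hp h hh)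

lemma parityChar_one_eq (hF : ringChar F ≠ 2) (ε : ℤ) :
    parityChar F n ε 1 = ((Fintype.card F : ℂ) ^ n + ε) / 2 := by
  classical
  have h : (1 : Module.End ℂ (Schr F n)) = mulOp fun _ => 1 :=
    LinearMap.ext fun f => funext fun t => (one_mul _).symm
  rw [parityChar, weilOperator_one hF, h, trace_mulOp_mul_parityProj hF]
  have h1 : ((Finset.univ.filter fun t : Fin n → F => t ≠ 0).card : ℂ) + 1 =
      (Fintype.card F : ℂ) ^ n := by
    rw [Finset.filter_ne']
    exact_mod_cast (Finset.card_erase_add_one (Finset.mem_univ (0 : Fin n → F))).trans (by simp)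
  rw [Finset.sum_const, nsmul_one, ← h1]
  ring

lemma parityChar_negOne_mul (hF : ringChar F ≠ 2) {ε : ℤ} (hε : ε = 1 ∨ ε = -1) (g : Sp F n) :
    parityChar F n ε (negOne F n * g) = ε * delta F ^ n * parityChar F n ε g := by
  have h : parityProj ε * (evenProj - oddProj) =
      (ε : ℂ) • (parityProj ε : Module.End ℂ (Schr F n)) := by
    refine LinearMap.ext fun f => funext fun t => ?_
    have hε2 : (ε : ℂ) * ε = 1 := by rcases hε with rfl | rfl <;> simp
    rw [Module.End.mul_apply, parityProj_apply, evenProj_sub_oddProj, evenProj_sub_oddProj,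
      LinearMap.smul_apply, Pi.smul_apply, parityProj_apply, smul_eq_mul, neg_neg]
    linear_combination (-f (-t) / 2) * hε2
  rw [parityChar, weilOperator_mul hF, weilOperator_negOne hF, smul_mul_assoc, smul_mul_assoc,
    map_smul, mul_assoc, LinearMap.trace_mul_comm, mul_assoc, h, mul_smul_comm, map_smul,
    parityChar, smul_eq_mul, smul_eq_mul]
  ring

lemma areWeilConstituents_parityChar (hF : ringChar F ≠ 2) (hn : 1 ≤ n) :
    AreWeilConstituents hF (parityChar F n 1) (parityChar F n (-1)) where
  irreducible_plus := isIrreducibleCharacter_parityChar hF hn (Or.inl rfl)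
  irreducible_minus := isIrreducibleCharacter_parityChar hF hn (Or.inr rfl)
  degree_plus := by rw [parityChar_one_eq hF]; simp
  degree_minus := by rw [parityChar_one_eq hF]; simp [sub_eq_add_neg]
  weilChar_eq := by
    funext g
    rw [Pi.add_apply, parityChar, parityChar, ← map_add, ← mul_add, parityProj_one,
      parityProj_neg_one, evenProj_add_oddProj, mul_one]
    rfl

/-- Both pairs are irreducible and have sum ω, and the degrees within a pair differ by 1, so
`IsIrreducibleCharacter.eq_of_add_eq` applies. -/
lemma AreWeilConstituents.eq_parityChar {hF : ringChar F ≠ 2} (hn : 1 ≤ n) {ωp ωm : Sp F n → ℂ}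
    (h : AreWeilConstituents hF ωp ωm) :
    ωp = parityChar F n 1 ∧ ωm = parityChar F n (-1) := by
  have h0 := areWeilConstituents_parityChar (F := F) hF hn
  have hne : ((Fintype.card F : ℂ) ^ n - 1) / 2 ≠ ((Fintype.card F : ℂ) ^ n + 1) / 2 := by
    intro h
    have : (1 : ℂ) = 0 := by linear_combination -h
    exact one_ne_zero this
  refine h.irreducible_plus.eq_of_add_eq h.irreducible_minus h0.irreducible_plus
    h0.irreducible_minus (h.weilChar_eq.symm.trans h0.weilChar_eq) ?_ ?_
  · rwa [h0.degree_plus, h0.degree_minus]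
  · rwa [h0.degree_plus, h.degree_minus]

/-! ### Restriction to G -/

lemma negOne_mul_negOne : negOne F n * negOne F n = 1 := by
  ext1
  simp [negOne]

lemma negOne_mul_comm (g : Sp F n) : negOne F n * g = g * negOne F n := by
  ext1
  simp [negOne]

/-- Every element of `G` is `g_Q` or `-g_Q` for a symmetric `Q`. -/
lemma eq_lower_or_eq_neg_lower {g : Sp F n} (hg : g ∈ subgroupG F n) :
    ∃ (Q : Matrix (Fin n) (Fin n) F) (hQ : Q.IsSymm),
      g = lower Q hQ ∨ g = negOne F n * lower Q hQ := by
  -- As -I is central, ⟨-I⟩ is normal and the join with B is the set of products.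
  have hnorm : (Subgroup.zpowers (negOne F n)).Normal := by
    refine ⟨fun x hx g => ?_⟩
    obtain ⟨k, rfl⟩ := Subgroup.mem_zpowers_iff.1 hx
    have : Commute g (negOne F n) := (negOne_mul_comm g).symm
    rw [(this.zpow_right k).eq, mul_inv_cancel_right]
    exact hx
  obtain ⟨x, hx, y, ⟨Q, hQ, rfl⟩, rfl⟩ := Subgroup.mem_sup_of_normal_left.1 hg
  obtain ⟨k, rfl⟩ := Subgroup.mem_zpowers_iff.1 hx
  refine ⟨Q, hQ, ?_⟩
  have h2 : negOne F n ^ (2 : ℤ) = 1 := by rw [zpow_two, negOne_mul_negOne]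
  rcases Int.even_or_odd' k with ⟨m, rfl | rfl⟩
  · left
    rw [zpow_mul, h2, one_zpow, one_mul]
  · right
    rw [zpow_add, zpow_mul, h2, one_zpow, one_mul, zpow_one]

/-- The restriction to `G` of the character on the functions of parity `ε`. -/
lemma parityChar_subgroupG (hF : ringChar F ≠ 2) (hn : 1 ≤ n) {ε : ℤ} (hε : ε = 1 ∨ ε = -1)
    (g : subgroupG F n) :
    parityChar F n ε g = (1 + ε) / 2 * lam (ε * delta F ^ n) 0 g +
      ∑ S ∈ rankOneSet F n, lam (ε * delta F ^ n) S g := by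
  obtain ⟨g, hg⟩ := g
  obtain ⟨Q, hQ, rfl | rfl⟩ := eq_lower_or_eq_neg_lower hg
  · simp only [lam_lower]
    rw [parityChar_lower hF]
    simp
  · simp only [lam_neg_lower hF hn]
    rw [parityChar_negOne_mul hF hε, parityChar_lower hF, ← Finset.mul_sum]
    simp
    ring

/-! ### Restriction to B and multiplicity freeness -/

/-- The linear character `g_Q ↦ ψ(Tr (S Q))` of `B`. -/
def lamB (S : Matrix (Fin n) (Fin n) F) : subgroupB F n →* ℂ where
  toFun b := canonicalChar F (S * b.1.1.toBlocks₂₁).trace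
  map_one' := by
    have h : (1 : Matrix (Fin n ⊕ Fin n) (Fin n ⊕ Fin n) F).toBlocks₂₁ = 0 := by
      rw [← Matrix.fromBlocks_one, Matrix.toBlocks_fromBlocks₂₁]
    change canonicalChar F (S * (1 : Matrix (Fin n ⊕ Fin n) (Fin n ⊕ Fin n) F).toBlocks₂₁).trace = 1
    rw [h]
    simp
  map_mul' := by
    rintro ⟨_, Q, hQ, rfl⟩ ⟨_, R, hR, rfl⟩
    change canonicalChar F (S * (lower Q hQ * lower R hR).1.toBlocks₂₁).trace = _
    rw [lower_mul]
    simp [lower, mul_add, AddChar.map_add_eq_mul]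

lemma lamB_lower (S : Matrix (Fin n) (Fin n) F) {Q : Matrix (Fin n) (Fin n) F} (hQ : Q.IsSymm) :
    lamB S ⟨lower Q hQ, lower_mem_subgroupB Q hQ⟩ = canonicalChar F (S * Q).trace := by
  change canonicalChar F (S * (lower Q hQ).1.toBlocks₂₁).trace = _
  simp [lower]

lemma conj_lamB (S : Matrix (Fin n) (Fin n) F) (b : subgroupB F n) :
    starRingEnd ℂ (lamB S b) = lamB S b⁻¹ := by
  have h : lamB S b * lamB S b⁻¹ = 1 := by rw [← map_mul, mul_inv_cancel, map_one]
  have h2 : lamB S b * starRingEnd ℂ (lamB S b) = 1 := by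
    change canonicalChar F _ * starRingEnd ℂ (canonicalChar F _) = 1
    rw [← AddChar.map_neg_eq_conj, ← AddChar.map_add_eq_mul, add_neg_cancel,
      AddChar.map_zero_eq_one]
  exact mul_left_cancel₀ (left_ne_zero_of_mul_eq_one h) (h2.trans h.symm)

/-- If S and T differ at (i, j), the matrices Q = b(e_ij + e_ji) separate their characters, since
Tr(RQ) = 2bR_ij for R symmetric and 2 is invertible. -/
lemma lamB_injOn (hF : ringChar F ≠ 2) :
    Set.InjOn (lamB (F := F) (n := n)) {S | S.IsSymm} := by
  intro S hS T hT h
  by_contra hne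
  obtain ⟨i, j, hij⟩ : ∃ i j, S i j ≠ T i j := by
    by_contra h0
    push Not at h0
    exact hne (Matrix.ext h0)
  obtain ⟨b, hb⟩ := exists_canonicalChar_ne_one F
    (mul_ne_zero (two_ne_zero' hF) (sub_ne_zero.2 hij))
  apply hb
  have hQ := Matrix.isSymm_add_transpose_self (Matrix.single i j b)
  have h1 := DFunLike.congr_fun h ⟨lower _ hQ, lower_mem_subgroupB _ hQ⟩
  rw [lamB_lower, lamB_lower] at h1
  have key : ∀ R : Matrix (Fin n) (Fin n) F, R.IsSymm →
      (R * (Matrix.single i j b + (Matrix.single i j b)ᵀ)).trace = b * (2 * R i j) := by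
    intro R hR
    rw [mul_add, Matrix.trace_add, ← Matrix.trace_transpose (R * (Matrix.single i j b)ᵀ),
      Matrix.transpose_mul, Matrix.transpose_transpose, hR.eq, Matrix.trace_mul_comm,
      Matrix.trace_single_mul, ← hR.apply i j, smul_eq_mul]
    ring
  rw [key S hS, key T hT] at h1
  have h2 : b * (2 * (S i j - T i j)) = b * (2 * S i j) + -(b * (2 * T i j)) := by ring
  rw [h2, AddChar.map_add_eq_mul, h1, ← AddChar.map_add_eq_mul, add_neg_cancel,
    AddChar.map_zero_eq_one]

lemma parityChar_subgroupB (hF : ringChar F ≠ 2) (ε : ℤ) (b : subgroupB F n) :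
    parityChar F n ε b = (1 + ε) / 2 + ∑ S ∈ rankOneSet F n, lamB S b := by
  obtain ⟨_, Q, hQ, rfl⟩ := b
  rw [parityChar_lower hF]
  exact congrArg _ (Finset.sum_congr rfl fun S _ => (lamB_lower S hQ).symm)

lemma isSymm_of_mem_rankOneSet {S : Matrix (Fin n) (Fin n) F} (hS : S ∈ rankOneSet F n) :
    S.IsSymm := by
  classical
  rw [rankOneSet, Finset.mem_filter] at hS
  exact hS.2.1

lemma zero_notMem_rankOneSet : (0 : Matrix (Fin n) (Fin n) F) ∉ rankOneSet F n := by
  classical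
  intro h
  rw [rankOneSet, Finset.mem_filter, Matrix.rank_zero] at h
  exact zero_ne_one h.2.2.1

lemma multiplicityFree_parityChar (hF : ringChar F ≠ 2) {ε : ℤ} (hε : ε = 1 ∨ ε = -1) :
    MultiplicityFree (fun b : subgroupB F n => parityChar F n ε b) := by
  classical
  rcases hε with rfl | rfl
  -- For ε = 1 the constant (1+ε)/2 = 1 is the character of S = 0, which is not of rank 1 and so
  -- enters as a new index.
  · have h := multiplicityFree_sum (insert 0 (rankOneSet F n)) (lamB (F := F) (n := n))
      ((lamB_injOn hF).mono fun S hS => by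
        rcases Finset.mem_insert.1 hS with rfl | hS
        · exact Matrix.isSymm_zero
        · exact isSymm_of_mem_rankOneSet hS) conj_lamB
    convert h using 2 with b
    rw [parityChar_subgroupB hF, Finset.sum_insert zero_notMem_rankOneSet]
    congr 1
    change _ = canonicalChar F (0 * _ : Matrix (Fin n) (Fin n) F).trace
    norm_num
  · have h := multiplicityFree_sum (rankOneSet F n) (lamB (F := F) (n := n))
      ((lamB_injOn hF).mono fun S hS => isSymm_of_mem_rankOneSet hS) conj_lamB
    convert h using 2 with b
    rw [parityChar_subgroupB hF]
    simp

lemma delta_eq (F : Type*) [Field F] [Fintype F] : delta F = 1 ∨ delta F = -1 := by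
  classical
  exact quadraticChar_dichotomy (neg_ne_zero.2 one_ne_zero)

end

end Weil

end

theorem mainTheorem2 (F : Type*) [Field F] [Fintype F] (hF : ringChar F ≠ 2)
    (n : ℕ) (hn : 1 ≤ n) :
    (∃ ωp ωm : Weil.Sp F n → ℂ, Weil.AreWeilConstituents hF ωp ωm) ∧
    ∀ ωp ωm : Weil.Sp F n → ℂ, Weil.AreWeilConstituents hF ωp ωm →
      (∀ g : Weil.subgroupG F n,
        ωp g = (1 + (Weil.delta F : ℂ) ^ n) / 2 * Weil.lam 1 0 g
          + (1 - (Weil.delta F : ℂ) ^ n) / 2 * Weil.lam (-1) 0 g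
          + ∑ S ∈ Weil.rankOneSet F n, Weil.lam (Weil.delta F ^ n) S g) ∧
      (∀ g : Weil.subgroupG F n,
        ωm g = ∑ S ∈ Weil.rankOneSet F n, Weil.lam (-Weil.delta F ^ n) S g) ∧
      Weil.MultiplicityFree (fun b : Weil.subgroupB F n => ωp b) ∧
      Weil.MultiplicityFree (fun b : Weil.subgroupB F n => ωm b) := by
  refine ⟨⟨_, _, Weil.areWeilConstituents_parityChar hF hn⟩, fun ωp ωm h => ?_⟩
  obtain ⟨rfl, rfl⟩ := h.eq_parityChar hn
  refine ⟨fun g => ?_, fun g => ?_, Weil.multiplicityFree_parityChar hF (Or.inl rfl),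
    Weil.multiplicityFree_parityChar hF (Or.inr rfl)⟩
  · rw [Weil.parityChar_subgroupG hF hn (Or.inl rfl), one_mul]
    congr 1
    -- Since δ^n = ±1, exactly one of the coefficients (1 ± δ^n)/2 is 1 and the other is 0, so the
    -- first two terms add up to λ_0 with sign δ^n.
    have hδ : Weil.delta F ^ n = 1 ∨ Weil.delta F ^ n = -1 := by
      rcases Weil.delta_eq F with h | h
      · left; rw [h, one_pow]
      · rw [h]; exact neg_one_pow_eq_or ℤ n
    rw [← Int.cast_pow]
    rcases hδ with h | h <;> rw [h] <;> norm_num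
  · rw [Weil.parityChar_subgroupG hF hn (Or.inr rfl), neg_one_mul]
    simp
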